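/- Conventions. Algebras are associative real algebras, not necessarily unital, and homomorphisms are $\mathbb{R}$-linear and multiplicative (not assumed unital) unless said otherwise. A topological algebra is a real topological vector space with separately continuous multiplication. An element $b$ of a real Banach algebra $B$ is of polynomial growth if there are $K>0$ and $\alpha\ge 0$ such that $\|e^{isb}\|\le K(1+|s|)^{\alpha}$ for all $s\in\mathbb{R}$, where the exponential is taken in the complexification of the algebra $B_+$ obtained from $B$ by adjoining an identity (with $\|t1+b\|=|t|+\|b\|$ on $B_+$, and on the complexification any complete algebra norm extending that of $B_+$, e.g. $\|a+ic\|=\|a\|+\|c\|$; the condition does not depend on this choice). $\mathsf{PG}$ is the class of real Banach algebras all of whose elements are of polynomial growth. A topological algebra is a $\mathsf{PGL}$ algebra if it is topologically isomorphic to the limit of a directed projective system of algebras in $\mathsf{PG}$ and continuous homomorphisms. An envelope of a topological algebra $A$ with respect to $\mathsf{PG}$ is a pair $(E,\iota)$ of a $\mathsf{PGL}$ algebra $E$ and a continuous homomorphism $\iota\colon A\to E$ such that for every $\mathsf{PGL}$ algebra $B$ (in particular, every $B\in\mathsf{PG}$) and every continuous homomorphism $\varphi\colon A\to B$ there is a unique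 continuous homomorphism $\widehat\varphi\colon E\to B$ with $\widehat\varphi\circ\iota=\varphi$. Let $\mathbb{R}[x,x^{-1}]$ be the algebra of real Laurent polynomials with the strongest locally convex topology, and let $C^\infty(\mathbb{R}\setminus\{0\})$ be the algebra of real-valued infinitely differentiable functions on $\mathbb{R}\setminus\{0\}$ with the topology of uniform convergence of all derivatives (of every order $\ge 0$) on compact subsets. Proposition. (1) The natural embedding $\mathbb{R}[x,x^{-1}]\to C^\infty(\mathbb{R}\setminus\{0\})$, sending $x$ to the coordinate function, is an envelope of $\mathbb{R}[x,x^{-1}]$ with respect to $\mathsf{PG}$. (2) Invertible elements of polynomial growth have a $C^\infty$-functional calculus: if $B$ is a unital real Banach algebra and $b\in B$ is invertible and of polynomial growth, then there is a unique continuous unital homomorphism $\Phi\colon C^\infty(\mathbb{R}\setminus\{0\})\to B$ that sends the coordinate function to $b$ (equivalently, that extends the homomorphism $\mathbb{R}[x,x^{-1}]\to B$, $x\mapsto b$). -/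

import Mathlib

open scoped ContDiff LaurentPolynomial UniformConvergence

universe u

namespace PGEnv

/-! ### The complexification of a real Banach algebra -/

section Complexification

/-- The underlying space of the complexification `R ⊗ ℂ` of a real normed algebra `R`: the pair
`(a, b)` stands for `a + i b`. It carries the norm `‖a + i b‖ = ‖a‖ + ‖b‖`, which extends the norm
of `R` and is submultiplicative. (Any complete algebra norm on the complexification that extends
the norm of a Banach algebra `R` is equivalent to this one.) -/
def Complexification (R : Type u) : Type u := WithLp 1 (R × R)

namespace Complexification

variable {R : Type u}

section

variable [NormedRing R]

noncomputable instance : NormedAddCommGroup (Complexification R) :=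
  inferInstanceAs (NormedAddCommGroup (WithLp 1 (R × R)))

instance [CompleteSpace R] : CompleteSpace (Complexification R) :=
  inferInstanceAs (CompleteSpace (WithLp 1 (R × R)))

end

/-- The element `a + i b`. -/
def mk (a b : R) : Complexification R := WithLp.toLp 1 (a, b)

/-- The real part. -/
def re (z : Complexification R) : R := WithLp.fst z

/-- The imaginary part. -/
def im (z : Complexification R) : R := WithLp.snd z

@[ext] theorem ext {z w : Complexification R} (h₁ : z.re = w.re) (h₂ : z.im = w.im) : z = w :=
  (WithLp.equiv 1 (R × R)).injective (Prod.ext h₁ h₂)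

@[simp] theorem re_mk (a b : R) : (mk a b).re = a := rfl
@[simp] theorem im_mk (a b : R) : (mk a b).im = b := rfl

variable [NormedRing R]

instance : One (Complexification R) := ⟨mk 1 0⟩

instance : Mul (Complexification R) :=
  ⟨fun z w => mk (z.re * w.re - z.im * w.im) (z.re * w.im + z.im * w.re)⟩

@[simp] theorem re_zero : (0 : Complexification R).re = 0 := rfl
@[simp] theorem im_zero : (0 : Complexification R).im = 0 := rfl
@[simp] theorem re_one : (1 : Complexification R).re = 1 := rfl
@[simp] theorem im_one : (1 : Complexification R).im = 0 := rfl
@[simp] theorem re_add (z w : Complexification R) : (z + w).re = z.re + w.re := rfl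
@[simp] theorem im_add (z w : Complexification R) : (z + w).im = z.im + w.im := rfl
@[simp] theorem re_mul (z w : Complexification R) :
    (z * w).re = z.re * w.re - z.im * w.im := rfl
@[simp] theorem im_mul (z w : Complexification R) :
    (z * w).im = z.re * w.im + z.im * w.re := rfl

theorem norm_def (z : Complexification R) : ‖z‖ = ‖z.re‖ + ‖z.im‖ :=
  WithLp.prod_norm_eq_of_L1 z

noncomputable instance : Ring (Complexification R) :=
  { (inferInstance : AddCommGroup (Complexification R)) with
    one := 1
    mul := (· * ·)
    left_distrib := fun a b c => by
      ext <;> simp [mul_add] <;> abel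
    right_distrib := fun a b c => by
      ext <;> simp [add_mul] <;> abel
    zero_mul := fun a => by ext <;> simp
    mul_zero := fun a => by ext <;> simp
    mul_assoc := fun a b c => by
      ext <;> simp [mul_add, add_mul, mul_sub, sub_mul, mul_assoc] <;> abel
    one_mul := fun a => by ext <;> simp
    mul_one := fun a => by ext <;> simp
    zsmul := fun n z => n • z
    zsmul_zero' := fun z => zero_zsmul z
    zsmul_succ' := fun n z => SubNegMonoid.zsmul_succ' n z
    zsmul_neg' := fun n z => SubNegMonoid.zsmul_neg' n z
    neg_add_cancel := fun z => neg_add_cancel z }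

noncomputable instance : NormedRing (Complexification R) :=
  { (inferInstance : NormedAddCommGroup (Complexification R)),
    (inferInstance : Ring (Complexification R)) with
    norm_mul_le := fun z w => by
      simp only [norm_def, re_mul, im_mul]
      have h₁ := norm_sub_le (z.re * w.re) (z.im * w.im)
      have h₂ := norm_add_le (z.re * w.im) (z.im * w.re)
      have h₃ := norm_mul_le z.re w.re
      have h₄ := norm_mul_le z.im w.im
      have h₅ := norm_mul_le z.re w.im
      have h₆ := norm_mul_le z.im w.re
      nlinarith }

variable [NormedAlgebra ℝ R]

/-- The complex algebra structure, `(s + i t) • (a + i b) = (s a - t b) + i (s b + t a)`. -/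
noncomputable instance : Algebra ℂ (Complexification R) where
  smul c z := mk (c.re • z.re - c.im • z.im) (c.re • z.im + c.im • z.re)
  algebraMap :=
    { toFun := fun c => mk (c.re • 1) (c.im • 1)
      map_one' := by ext <;> simp
      map_zero' := by ext <;> simp
      map_add' := fun c d => by ext <;> simp [add_smul]
      map_mul' := fun c d => by
        ext <;> simp [sub_smul, add_smul, smul_smul, mul_comm] }
  commutes' c z := by ext <;> simp [add_comm]
  smul_def' c z := by ext <;> simp <;> rfl

@[simp] theorem re_smul (c : ℂ) (z : Complexification R) :
    (c • z).re = c.re • z.re - c.im • z.im := rfl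
@[simp] theorem im_smul (c : ℂ) (z : Complexification R) :
    (c • z).im = c.re • z.im + c.im • z.re := rfl

/-- With the real scalars, this is a real normed algebra. -/
noncomputable instance : NormedAlgebra ℝ (Complexification R) :=
  { (inferInstance : Algebra ℝ (Complexification R)) with
    norm_smul_le := fun r z => by
      have h : r • z = (r : ℂ) • z := rfl
      rw [h, norm_def, norm_def, re_smul, im_smul]
      simp [norm_smul, mul_add] }

end Complexification
end Complexification

/-! ### Banach algebras of polynomial growth -/

section PolynomialGrowth

variable {B : Type u} [NonUnitalNormedRing B] [NormedSpace ℝ B] [IsScalarTower ℝ B B]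
  [SMulCommClass ℝ B B]

/-- For `b` in a real Banach algebra `B` (possibly without unit) and `s : ℝ`, the exponential
`exp (i s b)`, taken in the complexification of the algebra `B₊` obtained from `B` by adjoining an
identity; `B₊` has the norm `‖t 1 + b‖ = |t| + ‖b‖`. -/
noncomputable def expI (s : ℝ) (b : B) : Complexification (WithLp 1 (Unitization ℝ B)) :=
  NormedSpace.exp
    ((Complex.I * (s : ℂ)) • Complexification.mk (WithLp.toLp 1 (b : Unitization ℝ B)) 0)

/-- An element `b` of a real Banach algebra is of polynomial growth if
`‖exp (i s b)‖ ≤ K (1 + |s|) ^ α` for all real `s`, for some `K > 0` and `α ≥ 0`. -/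
def IsPolyGrowth (b : B) : Prop :=
  ∃ K : ℝ, 0 < K ∧ ∃ α : ℝ, 0 ≤ α ∧ ∀ s : ℝ, ‖expI s b‖ ≤ K * (1 + |s|) ^ α

end PolynomialGrowth

/-- A real Banach algebra, not necessarily with unit. -/
structure RealBanachAlg : Type (u + 1) where
  carrier : Type u
  [nonUnitalNormedRing : NonUnitalNormedRing carrier]
  [normedSpace : NormedSpace ℝ carrier]
  [isScalarTower : IsScalarTower ℝ carrier carrier]
  [smulCommClass : SMulCommClass ℝ carrier carrier]
  [completeSpace : CompleteSpace carrier]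

namespace RealBanachAlg

instance : CoeSort RealBanachAlg.{u} (Type u) := ⟨RealBanachAlg.carrier⟩

attribute [instance] nonUnitalNormedRing normedSpace isScalarTower smulCommClass completeSpace

/-- The class `PG`: every element is of polynomial growth. -/
def IsPG (B : RealBanachAlg.{u}) : Prop := ∀ b : B, IsPolyGrowth b

end RealBanachAlg

/-- A projective system, indexed by `ι`, of real Banach algebras of polynomial growth and
continuous homomorphisms. -/
structure PGSystem (ι : Type u) [Preorder ι] where
  obj : ι → RealBanachAlg.{u}
  isPG : ∀ i, (obj i).IsPG
  map : ∀ {i j : ι}, i ≤ j → (obj j →ₙₐ[ℝ] obj i)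
  continuous_map : ∀ {i j : ι} (h : i ≤ j), Continuous (map h)
  map_refl : ∀ (i : ι) (x : obj i), map (le_refl i) x = x
  map_map : ∀ {i j k : ι} (hij : i ≤ j) (hjk : j ≤ k) (x : obj k),
    map hij (map hjk x) = map (hij.trans hjk) x

/-- The projective limit of a system: the algebra of all compatible families, as a subalgebra
of the product, with the topology induced by the product topology. -/
def PGSystem.limit {ι : Type u} [Preorder ι] (S : PGSystem ι) :
    NonUnitalSubalgebra ℝ (∀ i, S.obj i) where
  carrier := {x | ∀ (i j : ι) (h : i ≤ j), S.map h (x j) = x i}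
  add_mem' := fun hx hy i j h => by simp [hx i j h, hy i j h]
  zero_mem' := fun i j h => by simp
  mul_mem' := fun hx hy i j h => by simp [hx i j h, hy i j h]
  smul_mem' := fun c x hx i j h => by simp [hx i j h]

section Envelope

/-- `A` is a `PGL` algebra (is locally in `PG`): it is isomorphic, as a topological algebra, to
the limit of a (directed) projective system of Banach algebras of polynomial growth. -/
def IsPGL (A : Type u) [NonUnitalRing A] [Module ℝ A] [TopologicalSpace A] : Prop :=
  ∃ (ι : Type u) (_ : Preorder ι) (_ : IsDirectedOrder ι) (_ : Nonempty ι) (S : PGSystem ι)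
    (e : A →ₙₐ[ℝ] S.limit), IsHomeomorph e

/-- `(E, ι)` is an envelope of the topological algebra `A` with respect to the class `PG`: `E` is
a `PGL` algebra, `ι : A → E` is a continuous homomorphism, and every continuous homomorphism from
`A` to a `PGL` algebra `B` factors through `ι` by a unique continuous homomorphism `E → B`; that
is, `ι` is a universal arrow from `A` to the forgetful functor from `PGL` algebras to topological
algebras. (`B` may be any Banach algebra of polynomial growth, in particular.) -/
structure IsPGEnvelope {A E : Type} [NonUnitalRing A] [Module ℝ A] [TopologicalSpace A]
    [NonUnitalRing E] [Module ℝ E] [TopologicalSpace E] (ι : A →ₙₐ[ℝ] E) : Prop where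
  isPGL : IsPGL E
  continuous : Continuous ι
  existsUnique_lift : ∀ (B : Type u) [NonUnitalRing B] [Module ℝ B] [IsScalarTower ℝ B B]
    [SMulCommClass ℝ B B] [TopologicalSpace B], IsPGL B →
    ∀ φ : A →ₙₐ[ℝ] B, Continuous φ → ∃! ψ : E →ₙₐ[ℝ] B, Continuous ψ ∧ ψ.comp ι = φ

end Envelope

/-! ### The strongest locally convex topology -/

/-- The finest topology that makes a real vector space a locally convex topological vector
space (it is the infimum of all such topologies; in Mathlib's order smaller means finer). -/
abbrev strongestLCTopology (V : Type u) [AddCommGroup V] [Module ℝ V] : TopologicalSpace V :=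
  sInf {t | @IsTopologicalAddGroup V t _ ∧ @ContinuousSMul ℝ V _ _ t ∧
    @LocallyConvexSpace ℝ V _ _ _ _ t}

/-- The algebra `ℝ[x, x⁻¹]` carries the strongest locally convex topology. -/
noncomputable instance : TopologicalSpace ℝ[T;T⁻¹] := strongestLCTopology ℝ[T;T⁻¹]

/-! ### The algebra of smooth functions on an open subset of the line -/

section Smooth

open TopologicalSpace

/-- Extension by zero of a function on an open subset `V` of `ℝ`. -/
noncomputable def ext {V : Opens ℝ} (f : V → ℝ) : ℝ → ℝ := Function.extend Subtype.val f 0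

theorem ext_apply {V : Opens ℝ} (f : V → ℝ) (x : V) : ext f x = f x :=
  Subtype.val_injective.extend_apply f 0 x

theorem ext_eqOn {V : Opens ℝ} {f : V → ℝ} {g : ℝ → ℝ} (h : ∀ x : V, f x = g x) :
    Set.EqOn (ext f) g V := fun x hx => (ext_apply f ⟨x, hx⟩).trans (h ⟨x, hx⟩)

/-- The algebra `C^∞(V)` of real-valued infinitely differentiable functions on `V`, with
pointwise operations. -/
noncomputable def Smooth (V : Opens ℝ) : Subalgebra ℝ (V → ℝ) where
  carrier := {f | ContDiffOn ℝ ∞ (ext f) V}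
  mul_mem' := fun {f g} hf hg =>
    (ContDiffOn.mul hf hg).congr (ext_eqOn fun x => by simp [ext_apply])
  add_mem' := fun {f g} hf hg =>
    (ContDiffOn.add hf hg).congr (ext_eqOn fun x => by simp [ext_apply])
  algebraMap_mem' := fun r =>
    (contDiffOn_const (c := r)).congr (ext_eqOn fun x => rfl)

/-- The `n`-th derivative of a smooth function on `V`, as a function on `V`. -/
noncomputable def nthDeriv {V : Opens ℝ} (n : ℕ) (f : Smooth V) : V → ℝ :=
  fun x => iteratedDeriv n (ext (f : V → ℝ)) x

/-- The usual topology of `C^∞(V)`: uniform convergence on the compact subsets of `V` of the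
functions and of all their derivatives. -/
noncomputable instance (V : Opens ℝ) : TopologicalSpace (Smooth V) :=
  ⨅ n : ℕ, TopologicalSpace.induced
    (fun f => UniformOnFun.ofFun {K : Set V | IsCompact K} (nthDeriv n f)) inferInstance

/-- `ℝ^× = ℝ ∖ {0}`. -/
def puncturedLine : Opens ℝ := ⟨{0}ᶜ, isOpen_compl_singleton⟩

theorem puncturedLine_ne (x : puncturedLine) : (x : ℝ) ≠ 0 := x.2

/-- The coordinate function `x` on `ℝ ∖ {0}`, as an invertible element of `C^∞(ℝ ∖ {0})`;
its inverse is the function `x⁻¹`. -/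
noncomputable def coordinate : (Smooth puncturedLine)ˣ where
  val := ⟨fun x => x, contDiffOn_id.congr (ext_eqOn fun x => rfl)⟩
  inv := ⟨fun x => (x : ℝ)⁻¹,
    (contDiffOn_inv ℝ).congr 
    (ext_eqOn (V := puncturedLine) (g := fun x => x⁻¹) fun _ => rfl)⟩
  val_inv := by ext x; exact mul_inv_cancel₀ (puncturedLine_ne x)
  inv_val := by ext x; exact inv_mul_cancel₀ (puncturedLine_ne x)

/-- The natural embedding `ℝ[x, x⁻¹] → C^∞(ℝ ∖ {0})`: evaluation of Laurent polynomials at the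
coordinate function. -/
noncomputable def laurentEmbedding : ℝ[T;T⁻¹] →ₐ[ℝ] Smooth puncturedLine :=
  { LaurentPolynomial.eval₂ (algebraMap ℝ (Smooth puncturedLine)) coordinate with
    commutes' := fun r => LaurentPolynomial.eval₂_C _ _ r }

end Smooth

end PGEnv

namespace PGEnv

/-! ### The topology of `C^∞(V)` through restricted derivatives. -/

section SmoothTopology

open TopologicalSpace Filter Topology

variable {V : Opens ℝ}

/-! The heart is a functional calculus. If `a` has polynomial growth in a commutative complex Banach
algebra, `∫ ĥ(s) exp(2πisa) ds` converges for every Schwartz `h`. Taking `h = χf`, with `χ` a cutoff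
equal to 1 near the real points of the spectrum, gives a continuous linear map `L` on `C^∞(V)`.
Integration by parts yields `L(xf) = a L(f)`. Growth forces every character `φ` to be real at `a`,
and Fourier inversion gives `φ(L 1) = χ(φ a) = 1`, so `L 1` is invertible. Then `f ↦ (L 1)⁻¹ L f`
sends a polynomial `p` to `p(a)`, and density of the polynomials makes it multiplicative
(`exists_calculus_complex`).

A real Banach algebra is a closed subalgebra of a complex Banach algebra of operators, where the
bicommutant of `a` supplies commutativity; density brings the values back (`exists_calculus`). A
homomorphism from the Laurent polynomials sends 1 to an idempotent; completing the image of `x` by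
the complementary idempotent gives a unit to which the calculus applies (`exists_extension`).
Projective limits are treated componentwise.

To see that `C^∞(V)` is a `PGL` algebra, control the `n`-th derivative on a compact set by a
homomorphism into an iterated square-zero extension of `C(K)`, with step `f ↦ f + εf'`. Exponentials
`exp(isf)` are bounded in `C(K)`, and commuting square-zero elements cost only a linear factor, so
these algebras are in `PG`. By completeness `C^∞(V)` is closed in their product, which suffices
(`isPGL_of_isClosedEmbedding`). -/

theorem Smooth.contDiffAt (f : Smooth V) {x : ℝ} (hx : x ∈ V) : ContDiffAt ℝ ∞ (ext f.1) x :=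
  (f.2 x hx).contDiffAt (V.isOpen.mem_nhds hx)

/-- The restriction to `V` of a function that is smooth on `V`. -/
def Smooth.of (g : ℝ → ℝ) (hg : ContDiffOn ℝ ∞ g V) : Smooth V :=
  ⟨fun x => g x, hg.congr (ext_eqOn fun _ => rfl)⟩

theorem nthDeriv_eq_of_eventuallyEq (f : Smooth V) {g : ℝ → ℝ} {x : V}
    (h : ext f.1 =ᶠ[𝓝 (x : ℝ)] g) (n : ℕ) : nthDeriv n f x = iteratedDeriv n g x :=
  h.iteratedDeriv_eq n

theorem ext_eventuallyEq {f : Smooth V} {g : ℝ → ℝ} (h : ∀ x : V, f.1 x = g x) (x : V) :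
    ext f.1 =ᶠ[𝓝 (x : ℝ)] g :=
  Filter.eventuallyEq_of_mem (V.isOpen.mem_nhds x.2) (ext_eqOn h)

theorem nthDeriv_of (g : ℝ → ℝ) (hg : ContDiffOn ℝ ∞ g V) (n : ℕ) (x : V) :
    nthDeriv n (Smooth.of g hg) x = iteratedDeriv n g x :=
  nthDeriv_eq_of_eventuallyEq _ (ext_eventuallyEq (fun _ => rfl) x) n

@[simp] theorem nthDeriv_zero (f : Smooth V) (x : V) : nthDeriv 0 f x = f.1 x := by
  simp [nthDeriv, ext_apply]

theorem nthDeriv_add (n : ℕ) (f g : Smooth V) : nthDeriv n (f + g) = nthDeriv n f + nthDeriv n g := by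
  funext x
  rw [nthDeriv_eq_of_eventuallyEq (f + g) (g := ext f.1 + ext g.1)
    (ext_eventuallyEq (fun y => by simp [ext_apply]) x)]
  exact iteratedDeriv_add ((Smooth.contDiffAt f x.2).of_le (by exact_mod_cast le_top))
    ((Smooth.contDiffAt g x.2).of_le (by exact_mod_cast le_top))

theorem nthDeriv_smul (n : ℕ) (c : ℝ) (f : Smooth V) : nthDeriv n (c • f) = c • nthDeriv n f := by
  funext x
  rw [nthDeriv_eq_of_eventuallyEq (c • f) (g := c • ext f.1)
    (ext_eventuallyEq (fun y => by simp [ext_apply]) x)]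
  exact iteratedDeriv_const_smul_field _ _

theorem continuous_nthDeriv (n : ℕ) (f : Smooth V) : Continuous (nthDeriv n f) := by
  have h : ContinuousOn (iteratedDeriv n (ext f.1)) V :=
    (f.2.continuousOn_iteratedDerivWithin (m := n) (by exact_mod_cast le_top)
      V.isOpen.uniqueDiffOn).congr (iteratedDerivWithin_of_isOpen V.isOpen).symm
  exact h.comp_continuous continuous_subtype_val fun x => x.2

/-- The restriction of the `n`-th derivative to a compact set. -/
noncomputable def jet (n : ℕ) (K : Compacts V) : Smooth V →ₗ[ℝ] C(K, ℝ) where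
  toFun f := ⟨fun x => nthDeriv n f x, (continuous_nthDeriv n f).comp continuous_subtype_val⟩
  map_add' f g := by ext x; simp [nthDeriv_add]
  map_smul' c f := by ext x; simp [nthDeriv_smul]

@[simp] theorem jet_apply (n : ℕ) (K : Compacts V) (f : Smooth V) (x : K) :
    jet n K f x = nthDeriv n f x := rfl

/-- Presents the topology as the initial one for linear maps into Banach spaces, so that vector
space properties and convergence criteria are inherited. -/
theorem smooth_topology_eq :
    (inferInstance : TopologicalSpace (Smooth V)) =
      ⨅ p : ℕ × Compacts V, .induced (jet p.1 p.2) inferInstance := by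
  rw [iInf_prod]
  refine iInf_congr fun n => ?_
  rw [UniformOnFun.topologicalSpace_eq, induced_iInf]
  apply le_antisymm
  · refine le_iInf fun K => (iInf_le _ (K : Set V)).trans ?_
    rw [induced_iInf]
    refine (iInf_le _ K.isCompact).trans (le_of_eq ?_)
    rw [induced_compose]
    exact ((congrArg (induced (jet n K))
      ContinuousMap.isUniformEmbedding_uniformFunOfFun.isInducing.eq_induced).trans
      induced_compose).symm
  · refine le_iInf fun K => ?_
    rw [induced_iInf]
    refine le_iInf fun hK => (iInf_le _ (⟨K, hK⟩ : Compacts V)).trans (le_of_eq ?_)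
    rw [induced_compose]
    exact (congrArg (induced (jet n ⟨K, hK⟩))
      ContinuousMap.isUniformEmbedding_uniformFunOfFun.isInducing.eq_induced).trans
      induced_compose

theorem isInducing_jets :
    IsInducing fun (f : Smooth V) (p : ℕ × Compacts V) => jet p.1 p.2 f := by
  constructor
  simp only [Pi.topologicalSpace, induced_iInf, induced_compose]
  exact smooth_topology_eq

theorem continuous_jet (n : ℕ) (K : Compacts V) : Continuous (jet n K) :=
  (continuous_apply (A := fun p : ℕ × Compacts V => C(p.2, ℝ)) (n, K)).comp isInducing_jets.continuous

theorem tendsto_smooth_iff {ι : Type*} {l : Filter ι} {F : ι → Smooth V} {f : Smooth V} :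
    Tendsto F l (𝓝 f) ↔ ∀ n K, Tendsto (fun i => jet n K (F i)) l (𝓝 (jet n K f)) := by
  rw [isInducing_jets.tendsto_nhds_iff, tendsto_pi_nhds, Prod.forall]
  rfl

theorem continuous_smooth_iff {X : Type*} [TopologicalSpace X] {F : X → Smooth V} :
    Continuous F ↔ ∀ n K, Continuous fun x => jet n K (F x) := by
  rw [isInducing_jets.continuous_iff, continuous_pi_iff, Prod.forall]
  rfl

instance : IsTopologicalAddGroup (Smooth V) := by
  have := topologicalAddGroup_iInf (ts' := fun p : ℕ × Compacts V =>
    .induced (jet (V := V) p.1 p.2) inferInstance) fun p => topologicalAddGroup_induced (jet p.1 p.2)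
  rwa [← smooth_topology_eq] at this

instance : ContinuousSMul ℝ (Smooth V) := by
  have := continuousSMul_iInf (M := ℝ) (ts' := fun p : ℕ × Compacts V =>
    .induced (jet (V := V) p.1 p.2) inferInstance) fun p => continuousSMul_induced (jet p.1 p.2)
  rwa [← smooth_topology_eq] at this

instance : LocallyConvexSpace ℝ (Smooth V) := by
  have := LocallyConvexSpace.iInf (𝕜 := ℝ) (ts' := fun p : ℕ × Compacts V =>
    .induced (jet (V := V) p.1 p.2) inferInstance) fun p => LocallyConvexSpace.induced (jet p.1 p.2)
  rwa [← smooth_topology_eq] at this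

instance : T2Space (Smooth V) := by
  have hinj : Function.Injective fun (f : Smooth V) (p : ℕ × Compacts V) => jet p.1 p.2 f := by
    intro f g h
    apply Subtype.ext
    funext x
    have := congrArg (fun φ => φ (⟨x, rfl⟩ : ({x} : Compacts V))) (congrFun h (0, ({x} : Compacts V)))
    simpa using this
  exact (IsEmbedding.mk isInducing_jets hinj).t2Space

/-- Differentiation on `C^∞(V)`. -/
noncomputable def smoothDeriv : Smooth V →ₗ[ℝ] Smooth V where
  toFun f := Smooth.of (deriv (ext f.1)) (f.2.deriv_of_isOpen V.isOpen le_rfl)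
  map_add' f g := by
    apply Subtype.ext
    funext x
    have := congrFun (nthDeriv_add 1 f g) x
    simp only [nthDeriv, Pi.add_apply, iteratedDeriv_one] at this
    exact this
  map_smul' c f := by
    apply Subtype.ext
    funext x
    have := congrFun (nthDeriv_smul 1 c f) x
    simp only [nthDeriv, Pi.smul_apply, iteratedDeriv_one] at this
    exact this

theorem nthDeriv_deriv (n : ℕ) (f : Smooth V) : nthDeriv n (smoothDeriv f) = nthDeriv (n + 1) f := by
  funext x
  refine (nthDeriv_of (deriv (ext f.1)) (f.2.deriv_of_isOpen V.isOpen le_rfl) n x).trans ?_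
  rw [nthDeriv, iteratedDeriv_succ']

theorem continuous_smoothDeriv : Continuous (smoothDeriv (V := V)) := by
  rw [continuous_smooth_iff]
  intro n K
  convert continuous_jet (n + 1) K using 2 with f
  ext x
  exact congrFun (nthDeriv_deriv n f) x

theorem smoothDeriv_mul (f g : Smooth V) : smoothDeriv (f * g) = f * smoothDeriv g + g * smoothDeriv f := by
  apply Subtype.ext
  funext x
  change deriv (ext (f * g).1) x = f.1 x * deriv (ext g.1) x +
    g.1 x * deriv (ext f.1) x
  have h : ext (f * g).1 =ᶠ[𝓝 (x : ℝ)] ext f.1 * ext g.1 :=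
    ext_eventuallyEq (fun y => by simp [ext_apply]) x
  rw [h.deriv_eq, deriv_mul ((Smooth.contDiffAt f x.2).differentiableAt (by simp))
    ((Smooth.contDiffAt g x.2).differentiableAt (by simp)), ext_apply, ext_apply]
  ring

end SmoothTopology

end PGEnv

namespace PGEnv

/-! ### Density of the polynomials in `C^∞(V)`. -/

section Density

open TopologicalSpace Filter Topology

theorem exists_derivative_eq (p : Polynomial ℝ) :
    ∃ q : Polynomial ℝ, Polynomial.derivative q = p := by
  induction p using Polynomial.induction_on' with
  | add p q hp hq =>
    obtain ⟨P, rfl⟩ := hp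
    obtain ⟨Q, rfl⟩ := hq
    exact ⟨P + Q, by simp⟩
  | monomial n a =>
    refine ⟨Polynomial.monomial (n + 1) (a / (n + 1)), ?_⟩
    rw [Polynomial.derivative_monomial]
    congr 1
    push_cast
    field_simp

/-- A smooth function can be approximated by polynomials, together with finitely many
derivatives, uniformly on a bounded interval. -/
theorem exists_polynomial_iteratedDeriv_near (M : ℝ) (N : ℕ) :
    ∀ (h : ℝ → ℝ), ContDiff ℝ ∞ h → ∀ ε : ℝ, 0 < ε → ∃ p : Polynomial ℝ, ∀ k ≤ N, ∀ x : ℝ, |x| ≤ M →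
      |iteratedDeriv k h x - iteratedDeriv k (fun y => p.eval y) x| < ε := by
  induction N with
  | zero =>
    intro h hh ε hε
    obtain ⟨p, hp⟩ := exists_polynomial_near_of_continuousOn (-M) M h hh.continuous.continuousOn ε hε
    refine ⟨p, fun k hk x hx => ?_⟩
    obtain rfl : k = 0 := by omega
    simpa [abs_sub_comm] using hp x (abs_le.1 hx)
  | succ N ih =>
    intro h hh ε hε
    rcases lt_or_ge M 0 with hM | hM
    · exact ⟨0, fun k _ x hx => absurd ((abs_nonneg x).trans hx) (not_le.2 hM)⟩
    obtain ⟨q, hq⟩ := ih (deriv h) ((contDiff_infty_iff_deriv.1 hh).2) (ε / (M + 1)) (by positivity)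
    obtain ⟨P, rfl⟩ := exists_derivative_eq q
    -- Since `p` and `h` agree at 0, the mean value inequality turns the derivative error `ε / (M +
    -- 1)` into at most `M ε / (M + 1) < ε`.
    let p : Polynomial ℝ := P + Polynomial.C (h 0 - P.eval 0)
    have hp : deriv (fun y => p.eval y) = fun y => (Polynomial.derivative P).eval y := by
      funext y
      simp [p]
    have hlt : ε / (M + 1) ≤ ε := div_le_self hε.le (by linarith)
    refine ⟨p, fun k hk x hx => ?_⟩
    cases k with
    | succ k =>
      rw [iteratedDeriv_succ', iteratedDeriv_succ', hp]
      exact (hq k (by omega) x hx).trans_le hlt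
    | zero =>
      have hd : ∀ y : ℝ, HasDerivAt (fun y => h y - p.eval y)
          (deriv h y - (Polynomial.derivative P).eval y) y := fun y =>
        ((hh.differentiable (by simp)) y).hasDerivAt.sub (by simpa [p] using p.hasDerivAt y)
      have := (convex_Icc (-M) M).norm_image_sub_le_of_norm_hasDerivWithin_le (C := ε / (M + 1))
        (fun y _ => (hd y).hasDerivWithinAt)
        (fun y hy => by simpa using (hq 0 (by omega) y (abs_le.2 hy)).le)
        (x := 0) (y := x) ⟨by linarith, hM⟩ (abs_le.1 hx)
      simp only [p, Polynomial.eval_add, Polynomial.eval_C, Real.norm_eq_abs, sub_zero,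
        add_sub_cancel, sub_self] at this
      simp only [iteratedDeriv_zero, p, Polynomial.eval_add, Polynomial.eval_C]
      refine this.trans_lt ?_
      calc ε / (M + 1) * |x| ≤ ε / (M + 1) * M := by gcongr
        _ < ε := by rw [div_mul_eq_mul_div, div_lt_iff₀ (by linarith)]; nlinarith

/-- A smooth cutoff function of a compact subset of an open set. -/
theorem exists_cutoff {K : Set ℝ} (hK : IsCompact K) {U : Set ℝ} (hU : IsOpen U) (hKU : K ⊆ U) :
    ∃ χ : ℝ → ℝ, ContDiff ℝ ∞ χ ∧ (∀ x ∈ K, χ =ᶠ[𝓝 x] 1) ∧ HasCompactSupport χ ∧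
      tsupport χ ⊆ U := by
  obtain ⟨L, hL, hKL, hLU⟩ := exists_compact_between hK hU hKU
  obtain ⟨f, h1, h0, -⟩ := exists_contMDiffMap_one_nhds_of_subset_interior (n := (⊤ : ℕ∞))
    (modelWithCornersSelf ℝ ℝ) hK.isClosed hKL
  have hsupp : Function.support f ⊆ L := fun x hx => by
    by_contra h
    exact hx (h0 x h)
  refine ⟨f, f.contMDiff.contDiff, fun x hx => ?_, ?_, ?_⟩
  · exact h1.filter_mono (nhds_le_nhdsSet hx)
  · exact HasCompactSupport.of_support_subset_isCompact hL hsupp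
  · exact (closure_minimal hsupp hL.isClosed).trans hLU

variable {V : Opens ℝ}

/-- Near a point outside `V` the cutoff vanishes identically, so bad behaviour of the extension by
zero at the boundary is harmless. -/
theorem contDiff_mul_ext {χ : ℝ → ℝ} (hχ : ContDiff ℝ ∞ χ) (hχV : tsupport χ ⊆ V)
    (f : Smooth V) : ContDiff ℝ ∞ (χ * ext f.1) := by
  rw [contDiff_iff_contDiffAt]
  intro x
  by_cases hx : x ∈ V
  · exact hχ.contDiffAt.mul (Smooth.contDiffAt f hx)
  · have h : χ * ext f.1 =ᶠ[𝓝 x] 0 := by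
      filter_upwards [notMem_tsupport_iff_eventuallyEq.1 fun h => hx (hχV h)] with y hy
      simp [hy]
    exact contDiffAt_const.congr_of_eventuallyEq h

/-- The coordinate function on `V`. -/
def Smooth.coord (V : Opens ℝ) : Smooth V := Smooth.of id contDiffOn_id

theorem aeval_coord_apply (p : Polynomial ℝ) (x : V) :
    (Polynomial.aeval (Smooth.coord V) p).1 x = p.eval (x : ℝ) := by
  induction p using Polynomial.induction_on' with
  | add p q hp hq => simp_all
  | monomial n a => simp [Smooth.coord, Smooth.of]

theorem nthDeriv_aeval_coord (n : ℕ) (p : Polynomial ℝ) (x : V) :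
    nthDeriv n (Polynomial.aeval (Smooth.coord V) p) x = iteratedDeriv n (fun y => p.eval y) x :=
  nthDeriv_eq_of_eventuallyEq _ (ext_eventuallyEq (fun y => aeval_coord_apply p y) x) n

/-- The polynomials are dense in `C^∞(V)`. -/
theorem denseRange_aeval_coord : DenseRange (Polynomial.aeval (R := ℝ) (Smooth.coord V)) := by
  intro f
  -- The error is tied to the order, so that the approximants form a net, indexed by orders and
  -- compact sets, converging for all seminorms at once.
  have key : ∀ q : ℕ × Compacts V, ∃ p : Polynomial ℝ, ∀ k ≤ q.1, ∀ x ∈ q.2,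
      |nthDeriv k f x - nthDeriv k (Polynomial.aeval (Smooth.coord V) p) x| < 1 / ((q.1 : ℝ) + 1) := by
    rintro ⟨N, K⟩
    have hK : IsCompact (Subtype.val '' (K : Set V) : Set ℝ) := K.isCompact.image continuous_subtype_val
    -- The cutoff makes `f` smooth on the whole line without changing its germs at points of `K`.
    obtain ⟨χ, hχ, hχ1, -, hχV⟩ := exists_cutoff hK V.isOpen (by rintro _ ⟨x, -, rfl⟩; exact x.2)
    obtain ⟨M, hM⟩ := hK.isBounded.exists_norm_le
    obtain ⟨p, hp⟩ := exists_polynomial_iteratedDeriv_near M N _ (contDiff_mul_ext hχ hχV f)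
      (1 / ((N : ℝ) + 1)) (by positivity)
    refine ⟨p, fun k hk x hx => ?_⟩
    have h := hp k hk x (hM _ ⟨x, hx, rfl⟩)
    rw [nthDeriv_aeval_coord, nthDeriv_eq_of_eventuallyEq f (g := χ * ext f.1)]
    · exact h
    · filter_upwards [hχ1 x ⟨x, hx, rfl⟩] with y hy
      simp [hy]
  choose p hp using key
  refine mem_closure_of_tendsto (b := atTop) (f := fun q => Polynomial.aeval (Smooth.coord V) (p q))
    ?_ (Eventually.of_forall fun q => ⟨p q, rfl⟩)
  rw [tendsto_smooth_iff]
  intro n K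
  rw [Metric.tendsto_nhds]
  intro ε hε
  obtain ⟨m, hm⟩ := exists_nat_one_div_lt hε
  filter_upwards [eventually_ge_atTop (max n m, K)] with q hq
  refine lt_of_le_of_lt ((ContinuousMap.dist_le (by positivity)).2 fun x => ?_) hm
  rw [dist_comm, Real.dist_eq]
  refine ((hp q n ((le_max_left _ _).trans hq.1) x (hq.2 x.2)).trans_le ?_).le
  gcongr
  exact (le_max_right n m).trans hq.1

end Density

end PGEnv

namespace PGEnv

/-! ### Polynomially bounded functions. -/

section PolynomiallyBounded

/-- A function on the line is polynomially bounded from above. -/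
def PolyBdd (f : ℝ → ℝ) : Prop := ∃ K : ℝ, ∃ n : ℕ, 0 ≤ K ∧ ∀ s, f s ≤ K * (1 + |s|) ^ n

theorem one_le_one_add_abs (s : ℝ) : 1 ≤ 1 + |s| := by linarith [abs_nonneg s]

theorem PolyBdd.mono {f g : ℝ → ℝ} (hg : PolyBdd g) (h : ∀ s, f s ≤ g s) : PolyBdd f := by
  obtain ⟨K, n, hK, hg⟩ := hg
  exact ⟨K, n, hK, fun s => (h s).trans (hg s)⟩

theorem polyBdd_const (c : ℝ) : PolyBdd fun _ => c :=
  ⟨|c|, 0, abs_nonneg c, fun s => by simpa using le_abs_self c⟩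

theorem polyBdd_abs : PolyBdd fun s => |s| := ⟨1, 1, zero_le_one, fun s => by simp⟩

theorem PolyBdd.add {f g : ℝ → ℝ} (hf : PolyBdd f) (hg : PolyBdd g) : PolyBdd fun s => f s + g s := by
  obtain ⟨K, n, hK, hf⟩ := hf
  obtain ⟨L, m, hL, hg⟩ := hg
  refine ⟨K + L, max n m, add_nonneg hK hL, fun s => ?_⟩
  have h1 := pow_le_pow_right₀ (one_le_one_add_abs s) (le_max_left n m)
  have h2 := pow_le_pow_right₀ (one_le_one_add_abs s) (le_max_right n m)
  calc f s + g s ≤ K * (1 + |s|) ^ n + L * (1 + |s|) ^ m := add_le_add (hf s) (hg s)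
    _ ≤ K * (1 + |s|) ^ max n m + L * (1 + |s|) ^ max n m := by gcongr
    _ = _ := by ring

theorem PolyBdd.mul {f g : ℝ → ℝ} (hf : PolyBdd f) (hg : PolyBdd g) (h0 : ∀ s, 0 ≤ g s) :
    PolyBdd fun s => f s * g s := by
  obtain ⟨K, n, hK, hf⟩ := hf
  obtain ⟨L, m, hL, hg⟩ := hg
  refine ⟨K * L, n + m, mul_nonneg hK hL, fun s => ?_⟩
  calc f s * g s ≤ (K * (1 + |s|) ^ n) * (L * (1 + |s|) ^ m) :=
        mul_le_mul (hf s) (hg s) (h0 s) (by positivity)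
    _ = _ := by ring

theorem PolyBdd.sum {ι : Type*} (s : Finset ι) {f : ι → ℝ → ℝ} (hf : ∀ i ∈ s, PolyBdd (f i)) :
    PolyBdd fun t => ∑ i ∈ s, f i t := by
  classical
  induction s using Finset.induction_on with
  | empty => simpa using polyBdd_const 0
  | insert a s ha ih =>
    simp only [Finset.sum_insert ha]
    exact (hf a (Finset.mem_insert_self a s)).add
      (ih fun i hi => hf i (Finset.mem_insert_of_mem hi))

end PolynomiallyBounded

/-! ### Universal property of the complexification. -/

namespace Complexification

variable {R : Type*} [NormedRing R]

theorem continuous_mk : Continuous fun p : R × R => mk p.1 p.2 :=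
  WithLp.prod_continuous_toLp 1 R R

theorem continuous_re : Continuous (re : Complexification R → R) :=
  continuous_fst.comp (WithLp.prod_continuous_ofLp 1 R R)

theorem continuous_im : Continuous (im : Complexification R → R) :=
  continuous_snd.comp (WithLp.prod_continuous_ofLp 1 R R)

variable [NormedAlgebra ℝ R]

instance : IsScalarTower ℝ ℂ (Complexification R) := IsScalarTower.of_algebraMap_eq fun _ => rfl

/-- The norm `‖a‖ + ‖b‖` is not homogeneous under complex scalars, which costs the factor 2. Genuine
complex Banach algebras are reached later through `regularRep`. -/
theorem norm_smul_le' (c : ℂ) (z : Complexification R) : ‖c • z‖ ≤ 2 * ‖c‖ * ‖z‖ := by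
  rw [norm_def, re_smul, im_smul, norm_def]
  have h1 := norm_sub_le (c.re • z.re) (c.im • z.im)
  have h2 := norm_add_le (c.re • z.im) (c.im • z.re)
  simp only [norm_smul, Real.norm_eq_abs] at h1 h2
  have h3 := Complex.abs_re_le_norm c
  have h4 := Complex.abs_im_le_norm c
  have h5 := norm_nonneg z.re
  have h6 := norm_nonneg z.im
  nlinarith

instance : ContinuousConstSMul ℂ (Complexification R) where
  continuous_const_smul c := by
    have : (fun z : Complexification R => c • z) =
        fun z => mk (c.re • z.re - c.im • z.im) (c.re • z.im + c.im • z.re) := rfl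
    rw [this]
    exact continuous_mk.comp (((continuous_re.const_smul _).sub (continuous_im.const_smul _)).prodMk
      ((continuous_im.const_smul _).add (continuous_re.const_smul _)))

/-- The embedding of a real algebra into its complexification. -/
noncomputable def ofReal : R →ₐ[ℝ] Complexification R where
  toFun a := mk a 0
  map_one' := rfl
  map_mul' a b := by ext <;> simp
  map_zero' := rfl
  map_add' a b := by ext <;> simp
  commutes' r := by
    change mk _ 0 = mk ((r : ℂ).re • 1) ((r : ℂ).im • 1)
    simp [Algebra.algebraMap_eq_smul_one]

theorem continuous_ofReal : Continuous (ofReal : R → Complexification R) :=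
  continuous_mk.comp (continuous_id.prodMk continuous_const)

variable {S : Type*} [Ring S] [Algebra ℝ S] [Algebra ℂ S] [IsScalarTower ℝ ℂ S]

/-- The extension of a homomorphism into a complex algebra to the complexification. -/
noncomputable def lift (θ : R →ₐ[ℝ] S) : Complexification R →ₐ[ℂ] S :=
  AlgHom.ofLinearMap
    { toFun := fun z => θ z.re + Complex.I • θ z.im
      map_add' := fun z w => by simp only [re_add, im_add, map_add, smul_add]; abel
      map_smul' := fun c z => by
        have h : ∀ (r : ℝ) (x : S), r • x = (r : ℂ) • x := fun r x => by
          rw [← one_smul ℂ x, ← smul_assoc, one_smul, Complex.real_smul, mul_one]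
        simp only [re_smul, im_smul, map_add, map_sub, map_smul, h, RingHom.id_apply, smul_add,
          smul_smul]
        conv_rhs => rw [← Complex.re_add_im c]
        simp only [add_smul, add_mul, mul_assoc]
        rw [show ((c.im : ℂ) * (Complex.I * Complex.I)) = -(c.im : ℂ) by simp, neg_smul,
          mul_comm Complex.I, mul_comm Complex.I]
        abel }
    (by simp)
    (fun z w => by
      simp only [LinearMap.coe_mk, AddHom.coe_mk, re_mul, im_mul, map_add, map_sub, map_mul,
        mul_add, add_mul, smul_add, smul_mul_assoc, mul_smul_comm, smul_smul, Complex.I_mul_I,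
        neg_smul, one_smul]
      abel)

theorem lift_apply (θ : R →ₐ[ℝ] S) (z : Complexification R) :
    lift θ z = θ z.re + Complex.I • θ z.im := rfl

theorem lift_ofReal (θ : R →ₐ[ℝ] S) (a : R) : lift θ (mk a 0) = θ a := by simp [lift_apply]

theorem continuous_lift [TopologicalSpace S] [ContinuousAdd S] [ContinuousConstSMul ℂ S]
    {θ : R →ₐ[ℝ] S} (hθ : Continuous θ) : Continuous (lift θ) :=
  (hθ.comp continuous_re).add ((hθ.comp continuous_im).const_smul _)

end Complexification

open Complexification

/-! ### Exponentials and polynomial growth in unital algebras. -/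

section Exponential

theorem map_exp_of_normedAlgebra {𝔸 𝔹 F : Type*} [NormedRing 𝔸] [NormedAlgebra ℝ 𝔸] [CompleteSpace 𝔸]
    [NormedRing 𝔹] [NormedAlgebra ℝ 𝔹] [FunLike F 𝔸 𝔹] [RingHomClass F 𝔸 𝔹] (f : F)
    (hf : Continuous f) (x : 𝔸) : f (NormedSpace.exp x) = NormedSpace.exp (f x) :=
  letI := NormedAlgebra.restrictScalars ℚ ℝ 𝔸
  letI := NormedAlgebra.restrictScalars ℚ ℝ 𝔹
  NormedSpace.map_exp f hf x

variable {R : Type*} [NormedRing R] [NormedAlgebra ℝ R]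

/-- The exponential `exp (i s a)` in the complexification of a unital algebra. -/
noncomputable def cexp (s : ℝ) (a : R) : Complexification R :=
  NormedSpace.exp ((Complex.I * (s : ℂ)) • mk a 0)

/-- `‖exp (i s a)‖` is polynomially bounded in `s`. -/
def HasPolyGrowth (a : R) : Prop := PolyBdd fun s => ‖cexp s a‖

/-- The exponential series stops: `exp(isa) = 1 + isa`. -/
theorem hasPolyGrowth_of_sq_eq_zero {a : R} (ha : a * a = 0) : HasPolyGrowth a := by
  refine ((polyBdd_const ‖(1 : Complexification R)‖).add
    (polyBdd_abs.mul (polyBdd_const (2 * ‖a‖)) fun _ => by positivity)).mono fun s => ?_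
  have hsq : ∀ k : ℕ, ((Complex.I * (s : ℂ)) • (mk a 0 : Complexification R)) ^ (k + 2) = 0 := by
    intro k
    rw [pow_add, smul_pow _ _ 2, sq (mk a 0), show (mk a 0 * mk a 0 : Complexification R) = 0 by
      ext <;> simp [ha], smul_zero, mul_zero]
  have : cexp s a = 1 + (Complex.I * (s : ℂ)) • mk a 0 := by
    rw [cexp, NormedSpace.exp_eq_tsum ℝ]
    change ∑' n : ℕ, _ = _
    rw [tsum_eq_sum (s := Finset.range 2)]
    · simp [Finset.sum_range_succ]
    · intro n hn
      obtain ⟨k, rfl⟩ := Nat.exists_eq_add_of_le' (Finset.mem_range.not.1 hn |> not_lt.1)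
      rw [hsq, smul_zero]
  rw [this]
  refine (norm_add_le _ _).trans ((add_le_add_iff_left _).2 ((norm_smul_le' _ _).trans (le_of_eq ?_)))
  rw [norm_def]
  simp
  ring

/-- Here `exp(isa) = e^{is} a + (1 - a)`, which is bounded in `s`. -/
theorem hasPolyGrowth_of_isIdempotentElem {a : R} (ha : IsIdempotentElem a) : HasPolyGrowth a := by
  refine (polyBdd_const (2 * ‖a‖ + ‖(mk (1 - a) 0 : Complexification R)‖)).mono fun s => ?_
  have hidem : IsIdempotentElem (mk a 0 : Complexification R) := ha.map ofReal
  set t : ℂ := Complex.I * (s : ℂ) with ht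
  have : cexp s a = Complex.exp t • mk a 0 + mk (1 - a) 0 := by
    have h1 : HasSum (fun n : ℕ => ((n.factorial : ℂ)⁻¹ • t ^ n) • (mk a 0 : Complexification R))
        (Complex.exp t • mk a 0) := by
      have := NormedSpace.exp_series_hasSum_exp' (𝕂 := ℂ) t
      rw [← Complex.exp_eq_exp_ℂ] at this
      have hc : Continuous fun z : ℂ => z • (mk a 0 : Complexification R) := by
        have : (fun z : ℂ => z • (mk a 0 : Complexification R)) =
            fun z => mk (z.re • a) (z.im • a) := by
          funext z
          ext <;> simp
        rw [this]
        exact continuous_mk.comp ((Complex.continuous_re.smul continuous_const).prodMk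
          (Complex.continuous_im.smul continuous_const))
      exact this.map (((LinearMap.id : ℂ →ₗ[ℂ] ℂ).smulRight
        (mk a 0 : Complexification R)).toAddMonoidHom) hc
    have h2 : HasSum (fun n : ℕ => if n = 0 then (mk (1 - a) 0 : Complexification R) else 0)
        (mk (1 - a) 0) := hasSum_ite_eq 0 _
    rw [cexp, NormedSpace.exp_eq_tsum ℂ]
    refine (tsum_congr fun n => ?_).trans (h1.add h2).tsum_eq
    cases n with
    | zero => ext <;> simp
    | succ n =>
      rw [smul_pow, hidem.pow_succ_eq, ← smul_assoc]
      simp [t]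
  rw [this]
  refine (norm_add_le _ _).trans ((add_le_add_iff_right _).2 ((norm_smul_le' _ _).trans (le_of_eq ?_)))
  rw [norm_def, ht, mul_comm Complex.I, Complex.norm_exp_ofReal_mul_I]
  simp

variable [CompleteSpace R]

theorem lift_cexp {S : Type*} [NormedRing S] [NormedAlgebra ℝ S] [Algebra ℂ S]
    [IsScalarTower ℝ ℂ S] [ContinuousConstSMul ℂ S] {θ : R →ₐ[ℝ] S} (hθ : Continuous θ) (s : ℝ)
    (a : R) : lift θ (cexp s a) = NormedSpace.exp ((Complex.I * (s : ℂ)) • θ a) := by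
  rw [cexp, map_exp_of_normedAlgebra (lift θ) (continuous_lift hθ), map_smul, lift_ofReal]

theorem cexp_add {a b : R} (h : Commute a b) (s : ℝ) : cexp s (a + b) = cexp s a * cexp s b := by
  let _ := NormedAlgebra.restrictScalars ℚ ℝ (Complexification R)
  have hab : Commute (mk a 0 : Complexification R) (mk b 0) := h.map ofReal
  rw [cexp, cexp, cexp, ← NormedSpace.exp_add_of_commute ((hab.smul_left _).smul_right _), ← smul_add]
  congr 2
  exact map_add ofReal a b

theorem HasPolyGrowth.add {a b : R} (ha : HasPolyGrowth a) (hb : HasPolyGrowth b)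
    (h : Commute a b) : HasPolyGrowth (a + b) :=
  (ha.mul hb fun _ => norm_nonneg _).mono fun s => by
    rw [cexp_add h]
    exact norm_mul_le _ _

end Exponential

/-! ### Homomorphisms on the unitization. -/

section NonUnital

variable {B : Type*} [NonUnitalNormedRing B] [NormedSpace ℝ B] [IsScalarTower ℝ B B]
  [SMulCommClass ℝ B B]

/-- The extension of a homomorphism into a unital algebra to the unitization. -/
noncomputable def unitizationLift {S : Type*} [Ring S] [Algebra ℝ S] (p : B →ₙₐ[ℝ] S) :
    WithLp 1 (Unitization ℝ B) →ₐ[ℝ] S :=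
  (Unitization.lift p).comp (WithLp.unitizationAlgEquiv ℝ).toAlgHom

theorem unitizationLift_apply {S : Type*} [Ring S] [Algebra ℝ S] (p : B →ₙₐ[ℝ] S)
    (z : WithLp 1 (Unitization ℝ B)) :
    unitizationLift p z = algebraMap ℝ S z.ofLp.fst + p z.ofLp.snd := rfl

theorem continuous_unitization_fst :
    Continuous fun z : WithLp 1 (Unitization ℝ B) => z.ofLp.fst :=
  continuous_fst.comp ((WithLp.prod_continuous_ofLp 1 ℝ B).comp
    (WithLp.uniformEquiv_unitization_addEquiv_prod ℝ B).continuous)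

theorem continuous_unitization_snd :
    Continuous fun z : WithLp 1 (Unitization ℝ B) => z.ofLp.snd :=
  continuous_snd.comp ((WithLp.prod_continuous_ofLp 1 ℝ B).comp
    (WithLp.uniformEquiv_unitization_addEquiv_prod ℝ B).continuous)

theorem continuous_unitizationLift {S : Type*} [NormedRing S] [NormedAlgebra ℝ S] {p : B →ₙₐ[ℝ] S}
    (hp : Continuous p) : Continuous (unitizationLift p) :=
  ((continuous_algebraMap ℝ S).comp continuous_unitization_fst).add
    (hp.comp continuous_unitization_snd)

/-- The embedding of an algebra into its unitization. -/
noncomputable def unitizationInr : B →ₙₐ[ℝ] WithLp 1 (Unitization ℝ B) :=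
  (((WithLp.unitizationAlgEquiv (𝕜 := ℝ) (A := B) ℝ).symm.toAlgHom :
    Unitization ℝ B →ₐ[ℝ] _) : Unitization ℝ B →ₙₐ[ℝ] _).comp (Unitization.inrNonUnitalAlgHom ℝ B)

theorem unitizationInr_apply (b : B) : unitizationInr b = WithLp.toLp 1 (b : Unitization ℝ B) := rfl

theorem continuous_unitizationInr : Continuous (unitizationInr : B → _) :=
  WithLp.unitization_isometry_inr.continuous

theorem expI_eq_cexp (s : ℝ) (b : B) : expI s b = cexp s (unitizationInr b) := rfl

end NonUnital

end PGEnv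

namespace PGEnv

open Complexification

/-! ### Polynomial growth in non-unital algebras. -/

section NonUnital

variable {B : Type*} [NonUnitalNormedRing B] [NormedSpace ℝ B] [IsScalarTower ℝ B B]
  [SMulCommClass ℝ B B]

theorem isPolyGrowth_iff (b : B) : IsPolyGrowth b ↔ HasPolyGrowth (unitizationInr b) := by
  constructor
  · rintro ⟨K, hK, α, -, h⟩
    refine ⟨K, ⌈α⌉₊, hK.le, fun s => (h s).trans ?_⟩
    rw [← Real.rpow_natCast]
    gcongr
    · exact one_le_one_add_abs s
    · exact Nat.le_ceil α
  · rintro ⟨K, n, hK, h⟩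
    refine ⟨K + 1, by positivity, n, by positivity, fun s => (h s).trans ?_⟩
    rw [Real.rpow_natCast]
    gcongr
    linarith

theorem polyBdd_norm_expI {b : B} (hb : IsPolyGrowth b) : PolyBdd fun s => ‖expI s b‖ :=
  (isPolyGrowth_iff b).1 hb

variable [CompleteSpace B]

theorem lift_expI {S : Type*} [NormedRing S] [NormedAlgebra ℝ S] [Algebra ℂ S]
    [IsScalarTower ℝ ℂ S] [ContinuousConstSMul ℂ S] {p : B →ₙₐ[ℝ] S} (hp : Continuous p) (s : ℝ)
    (b : B) :
    lift (unitizationLift p) (expI s b) = NormedSpace.exp ((Complex.I * (s : ℂ)) • p b) := by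
  rw [expI_eq_cexp, lift_cexp (continuous_unitizationLift hp), unitizationLift_apply]
  simp [unitizationInr_apply]

/-- The scalar part is the unital extension of the zero homomorphism `B → ℂ`, which sends `exp(isb)`
to `exp 0 = 1`. -/
theorem re_expI_fst (s : ℝ) (b : B) : (expI s b).re.ofLp.fst = 1 ∧ (expI s b).im.ofLp.fst = 0 := by
  have h := lift_expI (S := ℂ) (p := (0 : B →ₙₐ[ℝ] ℂ)) continuous_const s b
  rw [lift_apply, unitizationLift_apply, unitizationLift_apply] at h
  simp only [NonUnitalAlgHom.zero_apply, add_zero, Complex.coe_algebraMap, smul_eq_mul] at h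
  exact ⟨by simpa using congrArg Complex.re h, by simpa using congrArg Complex.im h⟩

theorem norm_expI (s : ℝ) (b : B) :
    ‖expI s b‖ = 1 + ‖(expI s b).re.ofLp.snd‖ + ‖(expI s b).im.ofLp.snd‖ := by
  rw [norm_def, WithLp.unitization_norm_def, WithLp.unitization_norm_def, (re_expI_fst s b).1,
    (re_expI_fst s b).2]
  simp

variable {B' : Type*} [NonUnitalNormedRing B'] [NormedSpace ℝ B'] [IsScalarTower ℝ B' B']
  [SMulCommClass ℝ B' B']

theorem expI_map {p : B →ₙₐ[ℝ] B'} (hp : Continuous p) (s : ℝ) (b : B) :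
    (expI s (p b)).re.ofLp.snd = p (expI s b).re.ofLp.snd ∧
      (expI s (p b)).im.ofLp.snd = p (expI s b).im.ofLp.snd := by
  let q : B →ₙₐ[ℝ] Complexification (WithLp 1 (Unitization ℝ B')) :=
    ((ofReal : WithLp 1 (Unitization ℝ B') →ₐ[ℝ] Complexification _) :
      WithLp 1 (Unitization ℝ B') →ₙₐ[ℝ] Complexification (WithLp 1 (Unitization ℝ B'))).comp
      (unitizationInr.comp p)
  have hq : ∀ x, q x = mk (WithLp.toLp 1 (p x : Unitization ℝ B')) 0 := fun _ => rfl
  have h : expI s (p b) = lift (unitizationLift q) (expI s b) :=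
    (lift_expI (p := q) (continuous_ofReal.comp (continuous_unitizationInr.comp hp)) s b).symm
  have h1 : (1 : WithLp 1 (Unitization ℝ B')).ofLp.snd = 0 := rfl
  rw [h, lift_apply, unitizationLift_apply, unitizationLift_apply, (re_expI_fst s b).1,
    (re_expI_fst s b).2, hq, hq]
  constructor <;> simp [h1]

/-- Homomorphisms carry exponentials to exponentials, so finitely many that jointly control the norm
also detect growth. This puts closed subalgebras of finite products of `PG` algebras in `PG`. -/
theorem IsPolyGrowth.of_norm_le_sum {ι : Type*} (t : Finset ι) {F : ι → Type*}
    [∀ i, NonUnitalNormedRing (F i)] [∀ i, NormedSpace ℝ (F i)] [∀ i, IsScalarTower ℝ (F i) (F i)]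
    [∀ i, SMulCommClass ℝ (F i) (F i)] [∀ i, CompleteSpace (F i)] (p : ∀ i, B →ₙₐ[ℝ] F i)
    (hp : ∀ i, Continuous (p i)) (hle : ∀ b, ‖b‖ ≤ ∑ i ∈ t, ‖p i b‖) {b : B}
    (hb : ∀ i ∈ t, IsPolyGrowth (p i b)) : IsPolyGrowth b := by
  rw [isPolyGrowth_iff]
  refine ((polyBdd_const 1).add (PolyBdd.sum t fun i hi => polyBdd_norm_expI (hb i hi))).mono
    fun s => ?_
  rw [← expI_eq_cexp, norm_expI, add_assoc]
  gcongr
  refine (add_le_add (hle _) (hle _)).trans ?_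
  rw [← Finset.sum_add_distrib]
  refine Finset.sum_le_sum fun i _ => ?_
  rw [norm_expI, (expI_map (hp i) s b).1, (expI_map (hp i) s b).2]
  linarith

theorem IsPolyGrowth.map [CompleteSpace B'] (p : B →ₙₐ[ℝ] B') (hp : ∀ b, ‖p b‖ ≤ ‖b‖) {b : B}
    (hb : IsPolyGrowth b) : IsPolyGrowth (p b) := by
  rw [isPolyGrowth_iff]
  refine (polyBdd_norm_expI hb).mono fun s => ?_
  have hc : Continuous p := AddMonoidHomClass.continuous_of_bound p 1 (by simpa using hp)
  rw [← expI_eq_cexp, norm_expI, norm_expI, (expI_map hc s b).1, (expI_map hc s b).2]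
  gcongr <;> exact hp _

theorem IsPolyGrowth.add_of_sq_eq_zero {a b : B} (ha : IsPolyGrowth a) (hb : b * b = 0)
    (hab : Commute a b) : IsPolyGrowth (a + b) := by
  rw [isPolyGrowth_iff, map_add]
  refine HasPolyGrowth.add ((isPolyGrowth_iff a).1 ha) (hasPolyGrowth_of_sq_eq_zero ?_)
    (hab.map unitizationInr)
  rw [← map_mul, hb, map_zero]

theorem isPolyGrowth_continuousMap {K : Type*} [TopologicalSpace K] [CompactSpace K] (f : C(K, ℝ)) :
    IsPolyGrowth f := by
  rw [isPolyGrowth_iff]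
  refine (polyBdd_const 4).mono fun s => ?_
  rw [← expI_eq_cexp, norm_expI]
  -- Evaluation at `x` gives `e^{isf(x)}`, of modulus 1. The summand 1 from the adjoined identity
  -- explains the bounds 2 and 1 on the two components, hence 4 in total.
  have key : ∀ x : K, ‖(1 : ℂ) + (expI s f).re.ofLp.snd x + Complex.I * (expI s f).im.ofLp.snd x‖ = 1 := by
    intro x
    let p : C(K, ℝ) →ₙₐ[ℝ] ℂ :=
      ((Complex.ofRealAm : ℝ →ₐ[ℝ] ℂ).comp (ContinuousMap.evalAlgHom ℝ ℝ x) : C(K, ℝ) →ₐ[ℝ] ℂ)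
    have h := lift_expI (p := p) (Complex.continuous_ofReal.comp (continuous_eval_const x)) s f
    rw [lift_apply, unitizationLift_apply, unitizationLift_apply, (re_expI_fst s f).1,
      (re_expI_fst s f).2] at h
    have hp : ∀ g, p g = (g x : ℂ) := fun _ => rfl
    simp only [hp, map_one, map_zero, zero_add, smul_eq_mul] at h
    rw [h, ← Complex.exp_eq_exp_ℂ, mul_assoc, ← Complex.ofReal_mul, mul_comm, Complex.norm_exp_ofReal_mul_I]
  have h1 : ‖(expI s f).re.ofLp.snd‖ ≤ 2 := by
    refine (ContinuousMap.norm_le _ zero_le_two).2 fun x => ?_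
    have := (Complex.abs_re_le_norm _).trans (key x).le
    simp [abs_le] at this
    rw [Real.norm_eq_abs, abs_le]
    constructor <;> linarith
  have h2 : ‖(expI s f).im.ofLp.snd‖ ≤ 1 := by
    refine (ContinuousMap.norm_le _ zero_le_one).2 fun x => ?_
    have := (Complex.abs_im_le_norm _).trans (key x).le
    simpa using this
  linarith

/-- An element is its base part plus a commuting element of square zero. -/
theorem isPolyGrowth_trivSqZeroExt {R : Type*} [NormedCommRing R] [NormedAlgebra ℝ R] [CompleteSpace R]
    (z : TrivSqZeroExt R R) (hz : IsPolyGrowth z.fst) : IsPolyGrowth z := by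
  rw [← TrivSqZeroExt.inl_fst_add_inr_snd_eq z]
  refine IsPolyGrowth.add_of_sq_eq_zero ?_ (TrivSqZeroExt.inr_mul_inr R _ _) (Commute.all _ _)
  exact IsPolyGrowth.map ((TrivSqZeroExt.inlAlgHom ℝ R R : R →ₐ[ℝ] _) : R →ₙₐ[ℝ] TrivSqZeroExt R R)
    (fun b => (TrivSqZeroExt.norm_inl b).le) hz

end NonUnital

end PGEnv

namespace PGEnv

/-! ### Closed subalgebras of products as projective limits. -/

section ProjectiveLimit

/-- The homomorphism into a product given by its components. -/
def piHom {ι A : Type*} {F : ι → Type*} [NonUnitalNonAssocSemiring A] [Module ℝ A]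
    [∀ i, NonUnitalNonAssocSemiring (F i)] [∀ i, Module ℝ (F i)] (p : ∀ i, A →ₙₐ[ℝ] F i) :
    A →ₙₐ[ℝ] ∀ i, F i where
  toFun a i := p i a
  map_smul' c a := by ext i; simp
  map_zero' := by ext i; simp
  map_add' a b := by ext i; simp
  map_mul' a b := by ext i; simp

/-- The evaluation homomorphism on a product. -/
def evalHom {ι : Type*} {F : ι → Type*} [∀ i, NonUnitalNonAssocSemiring (F i)]
    [∀ i, Module ℝ (F i)] (i : ι) : (∀ i, F i) →ₙₐ[ℝ] F i where
  toFun x := x i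
  map_smul' _ _ := rfl
  map_zero' := rfl
  map_add' _ _ := rfl
  map_mul' _ _ := rfl

variable {ι : Type u} (F : ι → RealBanachAlg.{u}) {A : Type u} [NonUnitalRing A] [Module ℝ A]
  (p : ∀ i, A →ₙₐ[ℝ] F i)

/-- The closure of the image of an algebra in a finite product of Banach algebras. -/
noncomputable def closedImage (t : Finset ι) : NonUnitalSubalgebra ℝ (∀ i : t, F i) :=
  (NonUnitalAlgHom.range (piHom fun i : t => p i)).topologicalClosure

theorem mem_closedImage {t : Finset ι} {x : ∀ i : t, F i} :
    x ∈ closedImage F p t ↔ x ∈ closure (Set.range fun a => fun i : t => p i a) := Iff.rfl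

/-- The closure of the image in a finite product, as a Banach algebra. -/
noncomputable def closedImageAlg (t : Finset ι) : RealBanachAlg.{u} where
  carrier := closedImage F p t
  normedSpace :=
    { (inferInstance : Module ℝ (closedImage F p t)) with
      norm_smul_le := fun c x => norm_smul_le c x.1 }
  isScalarTower := ⟨fun c x y => Subtype.ext (smul_assoc c x.1 y.1)⟩
  smulCommClass := ⟨fun c x y => Subtype.ext (smul_comm c x.1 y.1)⟩
  completeSpace := (NonUnitalSubalgebra.isClosed_topologicalClosure _).completeSpace_coe

/-- The restriction homomorphisms between the closed images. -/
noncomputable def closedImageMap {s t : Finset ι} (h : s ≤ t) :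
    closedImageAlg F p t →ₙₐ[ℝ] closedImageAlg F p s :=
  NonUnitalAlgHom.codRestrict
    ((piHom fun i : s => evalHom (F := fun i : t => (F i : Type u)) ⟨i, h i.2⟩).comp
      (NonUnitalSubalgebraClass.subtype (closedImage F p t)) :
        closedImage F p t →ₙₐ[ℝ] ∀ i : s, F i) (closedImage F p s) fun x => by
    refine map_mem_closure (f := fun (y : ∀ i : t, F i) (i : s) => y ⟨i, h i.2⟩)
      (continuous_pi fun i => continuous_apply _) x.2 ?_
    rintro _ ⟨a, rfl⟩
    exact ⟨a, rfl⟩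

/-- The projective system of the closed images in finite products. -/
noncomputable def closedImageSystem (hF : ∀ i, (F i).IsPG) : PGSystem (Finset ι) where
  obj := closedImageAlg F p
  isPG t b := by
    refine IsPolyGrowth.of_norm_le_sum (Finset.univ : Finset t) (F := fun i : t => (F i : Type u))
      (fun i => (evalHom i).comp (NonUnitalSubalgebraClass.subtype (closedImage F p t)))
      (fun i => (continuous_apply i).comp continuous_subtype_val) (fun x => ?_) fun i _ => hF i _
    refine (pi_norm_le_iff_of_nonneg (Finset.sum_nonneg fun i _ => norm_nonneg _)).2 fun i => ?_
    exact Finset.single_le_sum (f := fun i : t => ‖x.1 i‖) (fun i _ => norm_nonneg _) (Finset.mem_univ i)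
  map h := closedImageMap F p h
  continuous_map {s t} h := by
    have hc : Continuous fun (x : closedImage F p t) (i : s) => x.1 ⟨i, h i.2⟩ :=
      continuous_pi fun i => (continuous_apply _).comp continuous_subtype_val
    exact hc.subtype_mk _
  map_refl _ _ := rfl
  map_map _ _ _ := rfl

/-- Basic open sets of a product constrain finitely many coordinates, so the limit of the closed
images in finite subproducts is the closure of the image in the full product. A closed image is thus
the whole limit. -/
theorem isPGL_of_isClosedEmbedding [TopologicalSpace A] (hF : ∀ i, (F i).IsPG)
    (hp : Topology.IsClosedEmbedding fun (a : A) (i : ι) => p i a) : IsPGL A := by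
  classical
  let S := closedImageSystem F p hF
  let q (t : Finset ι) : A →ₙₐ[ℝ] closedImageAlg F p t :=
    NonUnitalAlgHom.codRestrict (piHom fun i : t => p i) (closedImage F p t)
      fun a => subset_closure ⟨a, rfl⟩
  let e : A →ₙₐ[ℝ] S.limit :=
    NonUnitalAlgHom.codRestrict (piHom (F := fun t => (S.obj t : Type u)) q) S.limit
      fun a s t h => rfl
  refine ⟨Finset ι, inferInstance, inferInstance, inferInstance, S, e, ?_⟩
  have hpc : ∀ i, Continuous (p i) := fun i => (continuous_apply i).comp hp.continuous
  have hqc : ∀ t, Continuous (q t) := fun t => by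
    have hc : Continuous fun (a : A) (i : t) => p i a := continuous_pi fun i => hpc i
    exact hc.subtype_mk _
  have hec : Continuous e := by
    have hc : Continuous fun (a : A) t => q t a := continuous_pi hqc
    exact hc.subtype_mk _
  let r : S.limit → ∀ i, F i := fun y i => (y.1 {i}).1 ⟨i, Finset.mem_singleton_self i⟩
  have hrc : Continuous r := continuous_pi fun i => (continuous_apply _).comp
    (continuous_subtype_val.comp ((continuous_apply ({i} : Finset ι)).comp continuous_subtype_val))
  have hre : r ∘ e = fun a i => p i a := rfl
  -- By compatibility, a point of the limit is determined by its components at singletons.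
  have hval : ∀ (y : S.limit) (t : Finset ι) (i : t), (y.1 t).1 i = r y i := by
    intro y t i
    have := y.2 {i.1} t (Finset.singleton_subset_iff.2 i.2)
    exact congrArg (fun z : closedImageAlg F p {i.1} => z.1 ⟨i, Finset.mem_singleton_self _⟩) this
  rw [isHomeomorph_iff_isEmbedding_surjective]
  refine ⟨⟨Topology.IsInducing.of_comp hec hrc (hre ▸ hp.isInducing),
    Function.Injective.of_comp (f := r) (hre ▸ hp.injective)⟩, fun y => ?_⟩
  have hy : r y ∈ closure (Set.range fun (a : A) (i : ι) => p i a) := by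
    rw [mem_closure_iff]
    intro U hU hyU
    obtain ⟨t, u, htu, hsub⟩ := isOpen_pi_iff.1 hU _ hyU
    have hopen : IsOpen {z : ∀ i : t, F i | ∀ i : t, z i ∈ u i} := by
      simp only [Set.ofPred_forall]
      exact isOpen_iInter_of_finite fun i => (htu i i.2).1.preimage (continuous_apply i)
    obtain ⟨_, hz, a, rfl⟩ := mem_closure_iff.1 ((mem_closedImage F p).1 (y.1 t).2) _ hopen
      fun i => by
        rw [hval y t i]
        exact (htu i i.2).2
    exact ⟨_, hsub fun i hi => hz ⟨i, hi⟩, a, rfl⟩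
  rw [hp.isClosed_range.closure_eq] at hy
  obtain ⟨a, ha⟩ := hy
  refine ⟨a, Subtype.ext (funext fun t => Subtype.ext (funext fun i => ?_))⟩
  exact (congrFun ha i).trans (hval y t i).symm

end ProjectiveLimit

end PGEnv

namespace PGEnv

/-! ### `C^∞(V)` is a `PGL` algebra. -/

section SmoothIsPGL

open TopologicalSpace Filter Topology

variable {V : Opens ℝ}

theorem hasDerivAt_iteratedDeriv_ext (f : Smooth V) (n : ℕ) {x : ℝ} (hx : x ∈ V) :
    HasDerivAt (iteratedDeriv n (ext f.1)) (iteratedDeriv (n + 1) (ext f.1) x) x := by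
  have h1 : DifferentiableOn ℝ (iteratedDerivWithin n (ext f.1) V) V :=
    f.2.differentiableOn_iteratedDerivWithin (by exact_mod_cast ENat.natCast_lt_top n)
      V.isOpen.uniqueDiffOn
  have h2 : DifferentiableOn ℝ (iteratedDeriv n (ext f.1)) V :=
    h1.congr (iteratedDerivWithin_of_isOpen V.isOpen).symm
  rw [iteratedDeriv_succ]
  exact ((h2 x hx).differentiableAt (V.isOpen.mem_nhds hx)).hasDerivAt

/-- The space `C^∞(V)` is complete. -/
theorem exists_le_nhds_of_cauchy_jets (l : Filter (Smooth V)) [l.NeBot]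
    (h : ∀ n K, Cauchy (map (jet n K) l)) : ∃ f, l ≤ 𝓝 f := by
  have hlim : ∀ n (K : Compacts V), ∃ G : C(K, ℝ), Tendsto (jet n K) l (𝓝 G) := fun n K =>
    CompleteSpace.complete (h n K)
  choose G hG using hlim
  -- The limits on singletons give global functions, to which the limits on all compact sets
  -- restrict.
  let g : ℕ → V → ℝ := fun n x => G n {x} ⟨x, rfl⟩
  have hpt : ∀ n (K : Compacts V) (x : K), Tendsto (fun f => nthDeriv n f x) l (𝓝 (G n K x)) := fun n K x =>
    ((continuous_eval_const x).tendsto _).comp (hG n K)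
  have hgG : ∀ n (K : Compacts V) (x : K), G n K x = g n x := fun n K x =>
    tendsto_nhds_unique (hpt n K x) (hpt n {x.1} ⟨x, rfl⟩)
  have hlu : ∀ n, TendstoLocallyUniformlyOn (fun (f : Smooth V) => iteratedDeriv n (ext f.1))
      (ext (g n)) l V := by
    intro n
    rw [tendstoLocallyUniformlyOn_iff_forall_isCompact V.isOpen]
    intro K' hK'V hK'
    let K : Compacts V := ⟨Subtype.val ⁻¹' K', by
      have h1 : (Subtype.val '' (Subtype.val ⁻¹' K' : Set V) : Set ℝ) = K' :=
        (Subtype.image_preimage_coe (V : Set ℝ) K').trans (Set.inter_eq_right.2 hK'V)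
      exact Subtype.isCompact_iff.2 (h1.symm ▸ hK')⟩
    rw [Metric.tendstoUniformlyOn_iff]
    intro ε hε
    filter_upwards [Metric.tendsto_nhds.1 (hG n K) ε hε] with f hf x hx
    have h1 := (ContinuousMap.dist_apply_le_dist (⟨⟨x, hK'V hx⟩, hx⟩ : K)).trans_lt hf
    rw [hgG, dist_comm] at h1
    rw [ext_apply (g n) ⟨x, hK'V hx⟩]
    exact h1
  -- Locally uniform convergence lets differentiation pass to the limit, so each limit is the
  -- derivative of the preceding one.
  have hderiv : ∀ n, ∀ x ∈ V, HasDerivAt (ext (g n)) (ext (g (n + 1)) x) x := fun n x hx =>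
    hasDerivAt_of_tendstoLocallyUniformlyOn V.isOpen (hlu (n + 1))
      (Eventually.of_forall fun f y hy => hasDerivAt_iteratedDeriv_ext f n hy)
      (fun y hy => (hlu n).tendsto_at hy) hx
  have hcd : ∀ m n : ℕ, ContDiffOn ℝ m (ext (g n)) V := by
    intro m
    induction m with
    | zero => exact fun n => contDiffOn_zero.2 fun x hx =>
        (hderiv n x hx).continuousAt.continuousWithinAt
    | succ m ih =>
      intro n
      push_cast
      refine (contDiffOn_succ_iff_deriv_of_isOpen V.isOpen).2
        ⟨fun x hx => (hderiv n x hx).differentiableAt.differentiableWithinAt, by simp, ?_⟩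
      exact (ih (n + 1)).congr fun x hx => (hderiv n x hx).deriv
  let f : Smooth V := ⟨g 0, contDiffOn_infty.2 fun m => hcd m 0⟩
  have hf : ∀ n, ∀ x ∈ V, iteratedDeriv n (ext f.1) x = ext (g n) x := by
    intro n
    induction n with
    | zero => exact fun x _ => by simp [f]
    | succ n ih =>
      intro x hx
      rw [iteratedDeriv_succ, (eventuallyEq_of_mem (V.isOpen.mem_nhds hx) ih).deriv_eq]
      exact (hderiv n x hx).deriv
  refine ⟨f, tendsto_id'.1 (tendsto_smooth_iff.2 fun n K => ?_)⟩
  have : jet n K f = G n K := by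
    ext x
    rw [hgG, jet_apply, ← ext_apply (g n)]
    exact hf n x x.1.2
  rw [this]
  exact hG n K

/-- The algebra `C^∞(V)` has enough homomorphisms to Banach algebras of polynomial growth. -/
theorem exists_comm_pg_hom (n : ℕ) (K : Compacts V) :
    ∃ (R : Type) (_ : NormedCommRing R) (_ : NormedAlgebra ℝ R) (_ : CompleteSpace R),
      (∀ b : R, IsPolyGrowth b) ∧
      ∃ π : Smooth V →ₐ[ℝ] R, Continuous π ∧ ∀ f, ‖jet n K f‖ ≤ ‖π f‖ := by
  induction n with
  | zero =>
    let π : Smooth V →ₐ[ℝ] C(K, ℝ) := AlgHom.ofLinearMap (jet 0 K) (by ext x; simp)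
      (fun f g => by ext x; simp)
    exact ⟨C(K, ℝ), inferInstance, inferInstance, inferInstance, isPolyGrowth_continuousMap, π,
      continuous_jet 0 K, fun f => le_rfl⟩
  | succ n ih =>
    obtain ⟨R, _, _, _, hR, π, hπ, hle⟩ := ih
    have h1 : smoothDeriv (1 : Smooth V) = 0 := by
      have := smoothDeriv_mul (1 : Smooth V) 1
      simpa using this
    -- First-order Taylor expansion `f ↦ π f + ε π f'`: the Leibniz rule is exactly multiplicativity
    -- modulo `ε²`, and one more derivative is controlled.
    let L : Smooth V →ₗ[ℝ] TrivSqZeroExt R R :=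
      { toFun := fun f => TrivSqZeroExt.inl (π f) + TrivSqZeroExt.inr (π (smoothDeriv f))
        map_add' := fun f g => by ext <;> simp
        map_smul' := fun c f => by ext <;> simp }
    let π' : Smooth V →ₐ[ℝ] TrivSqZeroExt R R := AlgHom.ofLinearMap L
      (by ext <;> simp [L, h1])
      (fun f g => by ext <;> simp [L, smoothDeriv_mul, mul_comm])
    refine ⟨TrivSqZeroExt R R, inferInstance, inferInstance, inferInstance,
      fun b => isPolyGrowth_trivSqZeroExt b (hR _), π', ?_, fun f => ?_⟩
    · exact (TrivSqZeroExt.continuous_inl.comp hπ).add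
        (TrivSqZeroExt.continuous_inr.comp (hπ.comp continuous_smoothDeriv))
    · have h2 : jet (n + 1) K f = jet n K (smoothDeriv f) := by
        ext x
        simp [nthDeriv_deriv]
      rw [h2]
      refine (hle _).trans ?_
      rw [TrivSqZeroExt.norm_def]
      simp [π', L]

theorem exists_pg_hom (n : ℕ) (K : Compacts V) :
    ∃ B : RealBanachAlg.{0}, B.IsPG ∧
      ∃ π : Smooth V →ₙₐ[ℝ] B, Continuous π ∧ ∀ f, ‖jet n K f‖ ≤ ‖π f‖ := by
  obtain ⟨R, _, _, _, hR, π, hπ, hle⟩ := exists_comm_pg_hom n K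
  exact ⟨⟨R⟩, hR, (π : Smooth V →ₙₐ[ℝ] R), hπ, hle⟩

/-- The homomorphisms of `exists_pg_hom` dominate all jet norms, so together they induce the
topology, and completeness makes their joint image closed. -/
theorem isPGL_smooth (V : Opens ℝ) : IsPGL (Smooth V) := by
  have key := fun q : ℕ × Compacts V => exists_pg_hom q.1 q.2
  choose F hF π hπ hle using key
  refine isPGL_of_isClosedEmbedding F π hF ?_
  have hsub : ∀ q f g, dist (jet q.1 q.2 f) (jet q.1 q.2 g) ≤ dist (π q f) (π q g) := by
    intro q f g
    rw [dist_eq_norm, dist_eq_norm, ← map_sub, ← map_sub]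
    exact hle q _
  have hc : Continuous fun (f : Smooth V) q => π q f := continuous_pi hπ
  have hind : IsInducing fun (f : Smooth V) q => π q f := by
    rw [isInducing_iff_nhds]
    intro f
    refine le_antisymm (hc.tendsto f).le_comap ?_
    refine tendsto_id'.1 (tendsto_smooth_iff.2 fun n K => ?_)
    rw [tendsto_iff_dist_tendsto_zero]
    have h1 : Tendsto (fun g => π (n, K) g) (comap (fun (f : Smooth V) q => π q f)
        (𝓝 fun q => π q f)) (𝓝 (π (n, K) f)) :=
      ((continuous_apply (n, K)).tendsto (fun q => π q f)).comp tendsto_comap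
    exact squeeze_zero (fun _ => dist_nonneg) (fun g => hsub (n, K) g f)
      (tendsto_iff_dist_tendsto_zero.1 h1)
  refine ⟨⟨hind, hind.injective⟩, isClosed_of_closure_subset fun x hx => ?_⟩
  let l := comap (fun (f : Smooth V) q => π q f) (𝓝 x)
  have hl : l.NeBot := comap_neBot_iff.2 fun t ht => by
    obtain ⟨_, hz, a, rfl⟩ := mem_closure_iff_nhds.1 hx t ht
    exact ⟨a, hz⟩
  have ht : Tendsto (fun (f : Smooth V) q => π q f) l (𝓝 x) := tendsto_comap
  obtain ⟨f, hf⟩ := exists_le_nhds_of_cauchy_jets l fun n K => by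
    have h1 : Cauchy (map (π (n, K)) l) :=
      (((continuous_apply (n, K)).tendsto x).comp ht).cauchy_map
    rw [Metric.cauchy_iff] at h1 ⊢
    refine ⟨hl.map _, fun ε hε => ?_⟩
    obtain ⟨t, ht, h⟩ := h1.2 ε hε
    refine ⟨_, image_mem_map ht, ?_⟩
    rintro _ ⟨f, hf, rfl⟩ _ ⟨g, hg, rfl⟩
    exact (hsub (n, K) f g).trans_lt (h _ hf _ hg)
  exact ⟨f, tendsto_nhds_unique ((hc.tendsto f).mono_left hf) ht⟩

end SmoothIsPGL

end PGEnv

namespace PGEnv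

/-! ### From smooth functions on `V` to Schwartz functions. -/

section Cutoff

open TopologicalSpace Filter Topology SchwartzMap

variable {V : Opens ℝ} {χ : ℝ → ℝ}

/-- Multiplication of smooth functions on `V` by a compactly supported cutoff function. -/
noncomputable def cutoffMap (hχ : ContDiff ℝ ∞ χ) (hc : HasCompactSupport χ) (hχV : tsupport χ ⊆ V) :
    Smooth V →ₗ[ℝ] 𝓢(ℝ, ℂ) where
  toFun f := HasCompactSupport.toSchwartzMap (f := fun x => ((χ x * ext f.1 x : ℝ) : ℂ))
    ((hc.mul_right (f' := ext f.1)).comp_left (g := ((↑) : ℝ → ℂ)) Complex.ofReal_zero)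
    (Complex.ofRealCLM.contDiff.comp (contDiff_mul_ext hχ hχV f))
  map_add' f g := by
    ext x
    by_cases hx : x ∈ V
    · have h := fun f : V → ℝ => ext_apply f ⟨x, hx⟩
      simp only [] at h
      simp [h, mul_add]
    · have : χ x = 0 := image_eq_zero_of_notMem_tsupport fun h => hx (hχV h)
      simp [this]
  map_smul' c f := by
    ext x
    by_cases hx : x ∈ V
    · have h := fun f : V → ℝ => ext_apply f ⟨x, hx⟩
      simp only [] at h
      simp [h, mul_left_comm]
    · have : χ x = 0 := image_eq_zero_of_notMem_tsupport fun h => hx (hχV h)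
      simp [this]

theorem cutoffMap_apply (hχ : ContDiff ℝ ∞ χ) (hc : HasCompactSupport χ) (hχV : tsupport χ ⊆ V)
    (f : Smooth V) (x : ℝ) : cutoffMap hχ hc hχV f x = ((χ x * ext f.1 x : ℝ) : ℂ) := rfl

/-- By the Leibniz rule, each Schwartz seminorm of `χf` is bounded by finitely many jet norms on the
support of `χ`. -/
theorem continuous_cutoffMap (hχ : ContDiff ℝ ∞ χ) (hc : HasCompactSupport χ)
    (hχV : tsupport χ ⊆ V) : Continuous (cutoffMap hχ hc hχV) := by
  refine (schwartz_withSeminorms ℝ ℝ ℂ).continuous_of_continuous_comp _ fun ⟨k, n⟩ => ?_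
  let K : Compacts V := ⟨Subtype.val ⁻¹' tsupport χ, by
    have h1 : (Subtype.val '' (Subtype.val ⁻¹' tsupport χ : Set V) : Set ℝ) = tsupport χ :=
      (Subtype.image_preimage_coe (V : Set ℝ) _).trans (Set.inter_eq_right.2 hχV)
    exact Subtype.isCompact_iff.2 (h1.symm ▸ hc)⟩
  obtain ⟨R, hR⟩ := hc.isCompact.isBounded.exists_norm_le
  have hb : ∀ i : ℕ, ∃ C, ∀ x, ‖iteratedDeriv i χ x‖ ≤ C := fun i => by
    have hcs : HasCompactSupport (iteratedFDeriv ℝ i χ) := hc.iteratedFDeriv i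
    obtain ⟨C, hC⟩ := hcs.exists_bound_of_continuous
      (hχ.continuous_iteratedFDeriv (by exact_mod_cast le_top))
    exact ⟨C, fun x => by rw [← norm_iteratedFDeriv_eq_norm_iteratedDeriv]; exact hC x⟩
  choose C hC using hb
  have hC0 : ∀ i, 0 ≤ C i := fun i => (norm_nonneg _).trans (hC i 0)
  let b : Smooth V → ℝ := fun f =>
    |R| ^ k * ∑ i ∈ Finset.range (n + 1), (n.choose i : ℝ) * C i * ‖jet (n - i) K f‖
  have hbound : ∀ f, SchwartzMap.seminorm ℝ k n (cutoffMap hχ hc hχV f) ≤ b f := by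
    intro f
    have hb0 : 0 ≤ b f := mul_nonneg (by positivity) (Finset.sum_nonneg fun i _ =>
      mul_nonneg (mul_nonneg (by positivity) (hC0 i)) (norm_nonneg _))
    refine seminorm_le_bound ℝ k n _ hb0 fun x => ?_
    have hcoe : (cutoffMap hχ hc hχV f : ℝ → ℂ) = Complex.ofRealLI ∘ (χ * ext f.1) := rfl
    rw [hcoe, Complex.ofRealLI.norm_iteratedFDeriv_comp_left (n := ∞)
      (contDiff_mul_ext hχ hχV f).contDiffAt (by exact_mod_cast le_top)]
    by_cases hx : x ∈ tsupport χ
    · rw [norm_iteratedFDeriv_eq_norm_iteratedDeriv, iteratedDeriv_mul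
        (hχ.contDiffAt.of_le (by exact_mod_cast le_top))
        ((Smooth.contDiffAt f (hχV hx)).of_le (by exact_mod_cast le_top))]
      refine mul_le_mul (pow_le_pow_left₀ (norm_nonneg x) ((hR x hx).trans (le_abs_self R)) k)
        ((norm_sum_le _ _).trans (Finset.sum_le_sum fun i _ => ?_)) (norm_nonneg _) (by positivity)
      rw [norm_mul, norm_mul]
      have h1 := (jet (n - i) K f).norm_coe_le_norm ⟨⟨x, hχV hx⟩, hx⟩
      have h2 : ‖((n.choose i : ℕ) : ℝ)‖ = n.choose i := by simp
      rw [h2]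
      exact mul_le_mul (mul_le_mul_of_nonneg_left (hC i x) (by positivity)) h1 (norm_nonneg _)
        (mul_nonneg (by positivity) (hC0 i))
    · have h0 : χ * ext f.1 =ᶠ[𝓝 x] fun _ => 0 := by
        filter_upwards [notMem_tsupport_iff_eventuallyEq.1 hx] with y hy
        simp [hy]
      rw [h0.iteratedFDeriv ℝ n |>.eq_of_nhds]
      simp only [iteratedFDeriv_fun_zero, Pi.zero_apply, norm_zero, mul_zero]
      exact hb0
  have hbc : Continuous b := continuous_const.mul (continuous_finsetSum _ fun i _ =>
    continuous_const.mul (continuous_jet (n - i) K).norm)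
  refine Seminorm.continuous_of_continuousAt_zero ?_
  rw [ContinuousAt, map_zero]
  refine squeeze_zero (fun f => apply_nonneg _ f) (fun f => hbound f) ?_
  have := hbc.tendsto 0
  simpa [b] using this

end Cutoff

/-! ### The Fourier integral calculus on Schwartz functions. -/

section SchwartzCalculus

open TopologicalSpace Filter Topology SchwartzMap FourierTransform MeasureTheory Real

theorem PolyBdd.comp_mul {f : ℝ → ℝ} (hf : PolyBdd f) (c : ℝ) : PolyBdd fun s => f (c * s) := by
  obtain ⟨K, n, hK, hf⟩ := hf
  refine ⟨K * (1 + |c|) ^ n, n, by positivity, fun s => (hf _).trans ?_⟩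
  rw [mul_assoc, ← mul_pow, abs_mul]
  gcongr
  nlinarith [abs_nonneg c, abs_nonneg s]

theorem not_polyBdd_exp {c : ℝ} (hc : 0 < c) : ¬ PolyBdd fun s => Real.exp (c * s) := by
  rintro ⟨K, n, hK, h⟩
  have ho := (isLittleO_pow_exp_pos_mul_atTop n hc).bound
    (show (0 : ℝ) < 1 / (2 * (K * 2 ^ n + 1)) by positivity)
  obtain ⟨s, hs, hs1⟩ := (ho.and (eventually_ge_atTop 1)).exists
  have h1 : (1 + |s|) ^ n ≤ 2 ^ n * s ^ n := by
    rw [← mul_pow, abs_of_nonneg (by linarith)]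
    exact pow_le_pow_left₀ (by linarith) (by linarith) n
  rw [Real.norm_of_nonneg (by positivity), Real.norm_of_nonneg (by positivity)] at hs
  have hE := Real.exp_pos (c * s)
  have h2 : Real.exp (c * s) ≤ K * (2 ^ n * (1 / (2 * (K * 2 ^ n + 1)) * Real.exp (c * s))) :=
    (h s).trans (by gcongr; exact h1.trans (by gcongr))
  have h3 : K * (2 ^ n * (1 / (2 * (K * 2 ^ n + 1)) * Real.exp (c * s))) =
      (K * 2 ^ n) / (2 * (K * 2 ^ n + 1)) * Real.exp (c * s) := by field_simp
  have h4 : (K * 2 ^ n) / (2 * (K * 2 ^ n + 1)) < 1 := by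
    rw [div_lt_one (by positivity)]
    nlinarith [show 0 ≤ K * 2 ^ n by positivity]
  nlinarith

theorem eq_zero_of_polyBdd_exp {c : ℝ} (h : PolyBdd fun s => Real.exp (c * s)) : c = 0 := by
  rcases lt_trichotomy c 0 with hc | hc | hc
  · have := h.comp_mul (-1)
    refine absurd ?_ (not_polyBdd_exp (neg_pos.2 hc))
    simpa using this
  · exact hc
  · exact absurd h (not_polyBdd_exp hc)

variable {A : Type*} [NormedRing A] [NormedAlgebra ℂ A] [CompleteSpace A]

/-- The `n`-th derivative is `exp(sw) wⁿ`, so one bound on the function serves all derivatives. -/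
theorem hasTemperateGrowth_exp_smul {w : A} (hw : PolyBdd fun s => ‖NormedSpace.exp (s • w)‖) :
    (fun s : ℝ => NormedSpace.exp (s • w)).HasTemperateGrowth := by
  have hd : ∀ n : ℕ, ∀ s : ℝ, HasDerivAt (fun s : ℝ => NormedSpace.exp (s • w) * w ^ n)
      (NormedSpace.exp (s • w) * w ^ (n + 1)) s := fun n s => by
    rw [pow_succ', ← mul_assoc]
    exact (hasDerivAt_exp_smul_const w s).mul_const _
  have hit : ∀ n : ℕ, iteratedDeriv n (fun s : ℝ => NormedSpace.exp (s • w)) =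
      fun s => NormedSpace.exp (s • w) * w ^ n := by
    intro n
    induction n with
    | zero => simp
    | succ n ih =>
      rw [iteratedDeriv_succ, ih]
      exact funext fun s => (hd n s).deriv
  refine ⟨contDiff_of_differentiable_iteratedDeriv fun n _ => ?_, fun n => ?_⟩
  · rw [hit]
    exact fun s => (hd n s).differentiableAt
  · obtain ⟨K, k, hK, h⟩ := hw
    refine ⟨k, K * ‖w ^ n‖, fun s => ?_⟩
    rw [norm_iteratedFDeriv_eq_norm_iteratedDeriv, hit, mul_right_comm]
    exact (norm_mul_le _ _).trans (mul_le_mul_of_nonneg_right (h s) (norm_nonneg _))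

/-- The map `h ↦ ∫ ĥ(s) exp (s w) ds` on the Schwartz space. -/
noncomputable def schwartzCalc {w : A} (hw : PolyBdd fun s => ‖NormedSpace.exp (s • w)‖) :
    𝓢(ℝ, ℂ) →L[ℂ] A :=
  (integralCLM ℂ volume).comp
    ((bilinLeftCLM (ContinuousLinearMap.lsmul ℂ ℂ : ℂ →L[ℂ] A →L[ℂ] A)
      (hasTemperateGrowth_exp_smul hw)).comp (fourierTransformCLM ℂ))

theorem schwartzCalc_apply {w : A} (hw : PolyBdd fun s => ‖NormedSpace.exp (s • w)‖) (h : 𝓢(ℝ, ℂ)) :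
    schwartzCalc hw h = ∫ s, 𝓕 h s • NormedSpace.exp (s • w) := rfl

theorem integrable_schwartz_smul_exp {w : A} (hw : PolyBdd fun s => ‖NormedSpace.exp (s • w)‖)
    (h : 𝓢(ℝ, ℂ)) : Integrable fun s => h s • NormedSpace.exp (s • w) :=
  (bilinLeftCLM (ContinuousLinearMap.lsmul ℂ ℂ : ℂ →L[ℂ] A →L[ℂ] A)
      (hasTemperateGrowth_exp_smul hw) h).integrable

/-- Integration by parts: the Fourier transform satisfies `ĥ₁' = -2πi ĥ₂`, while `exp(sw)` has
derivative `exp(sw) w`. -/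
theorem schwartzCalc_mul_coord {w : A} (hw : PolyBdd fun s => ‖NormedSpace.exp (s • w)‖)
    {h₁ h₂ : 𝓢(ℝ, ℂ)} (h : ∀ x, h₂ x = x * h₁ x) :
    (2 * π * Complex.I) • schwartzCalc hw h₂ = schwartzCalc hw h₁ * w := by
  have hder : ∀ s, HasDerivAt (𝓕 h₁ : 𝓢(ℝ, ℂ)) ((-(2 * π * Complex.I)) * (𝓕 h₂ : 𝓢(ℝ, ℂ)) s) s := by
    intro s
    have hfun : (fun x : ℝ => x • h₁ x) = h₂ := by
      funext x
      rw [h x, Complex.real_smul]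
    have h1 := Real.hasDerivAt_fourier (f := h₁) h₁.integrable (hfun ▸ h₂.integrable) s
    have h2 : (fun x : ℝ => (-2 * (π : ℂ) * Complex.I * x) • h₁ x) =
        (-(2 * π * Complex.I) • h₂ : 𝓢(ℝ, ℂ)) := by
      funext x
      simp [h x]
      ring
    rw [h2, ← fourier_coe, ← fourier_coe, FourierTransform.fourier_smul] at h1
    exact h1
  have hparts := integral_bilinear_hasDerivAt_right_eq_neg_left_of_integrable
    (L := ContinuousLinearMap.lsmul ℝ ℂ (E := A))
    (u := (𝓕 h₁ : 𝓢(ℝ, ℂ))) (v := fun s : ℝ => NormedSpace.exp (s • w))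
    (fun s _ => hder s) (fun s _ => hasDerivAt_exp_smul_const w s)
    (by simpa using (integrable_schwartz_smul_exp hw (𝓕 h₁)).mul_const w)
    (by
      simp only [ContinuousLinearMap.lsmul_apply, mul_smul]
      exact (integrable_schwartz_smul_exp hw (𝓕 h₂)).smul (-(2 * π * Complex.I)))
    (integrable_schwartz_smul_exp hw (𝓕 h₁))
  simp only [ContinuousLinearMap.lsmul_apply, neg_mul, neg_smul, integral_neg, neg_neg, mul_smul]
    at hparts
  rw [schwartzCalc_apply, schwartzCalc_apply, ← integral_mul_const_of_integrable
    (integrable_schwartz_smul_exp hw _)]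
  simp only [smul_mul_assoc]
  rw [hparts]
  simp only [mul_smul, integral_smul]

end SchwartzCalculus

end PGEnv

namespace PGEnv

section SeparateContinuity

open TopologicalSpace Filter Topology

variable {V : Opens ℝ}

/-- Multiplication in `C^∞(V)` is separately continuous. -/
theorem continuous_smooth_mul_const (g : Smooth V) : Continuous fun f : Smooth V => f * g := by
  rw [continuous_smooth_iff]
  intro n K
  obtain ⟨B, -, π, hπ, hle⟩ := exists_pg_hom n K
  rw [continuous_iff_continuousAt]
  intro f
  rw [ContinuousAt, tendsto_iff_dist_tendsto_zero]
  have h1 : Tendsto (fun h => ‖π h - π f‖ * ‖π g‖) (𝓝 f) (𝓝 0) := by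
    have : Tendsto (fun h => ‖π h - π f‖ * ‖π g‖) (𝓝 f) (𝓝 (‖π f - π f‖ * ‖π g‖)) :=
      ((hπ.sub continuous_const).norm.mul continuous_const).tendsto f
    simpa using this
  refine squeeze_zero (fun _ => dist_nonneg) (fun h => ?_) h1
  rw [dist_eq_norm, ← map_sub, ← sub_mul]
  refine (hle _).trans ?_
  rw [map_mul, map_sub]
  exact norm_mul_le _ _

end SeparateContinuity

/-! ### The calculus in a commutative complex Banach algebra. -/

section ComplexCalculus

open TopologicalSpace Filter Topology SchwartzMap FourierTransform MeasureTheory Real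

variable {V : Opens ℝ}

variable {A : Type*} [NormedCommRing A] [NormedAlgebra ℂ A]

/-- The choice `w = 2πi a` matches the normalization of the Fourier transform. -/
theorem polyBdd_exp_two_pi {a : A}
    (ha : PolyBdd fun s : ℝ => ‖NormedSpace.exp ((Complex.I * (s : ℂ)) • a)‖) :
    PolyBdd fun s : ℝ => ‖NormedSpace.exp (s • ((2 * π * Complex.I) • a))‖ := by
  refine (ha.comp_mul (2 * π)).mono fun s => le_of_eq ?_
  rw [← Complex.coe_smul s, smul_smul]
  congr 3
  push_cast
  ring

variable [CompleteSpace A]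

theorem character_exp (φ : WeakDual.characterSpace ℂ A) (a : A) :
    φ (NormedSpace.exp a) = Complex.exp (φ a) := by
  rw [Complex.exp_eq_exp_ℂ]
  exact map_exp_of_normedAlgebra φ (map_continuous φ) a

/-- The modulus of `φ(exp(isa))` is `exp(-s Im φ(a))`; a polynomial bound for `s` of both signs
forces the exponent to vanish. -/
theorem character_im_eq_zero {a : A}
    (ha : PolyBdd fun s : ℝ => ‖NormedSpace.exp ((Complex.I * (s : ℂ)) • a)‖)
    (φ : WeakDual.characterSpace ℂ A) : (φ a).im = 0 := by
  refine neg_eq_zero.1 (eq_zero_of_polyBdd_exp (((polyBdd_const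
    ‖WeakDual.CharacterSpace.toCLM φ‖).mul ha fun _ => norm_nonneg _).mono fun s => ?_))
  have h := (WeakDual.CharacterSpace.toCLM φ).le_opNorm (NormedSpace.exp ((Complex.I * (s : ℂ)) • a))
  have h2 : WeakDual.CharacterSpace.toCLM φ (NormedSpace.exp ((Complex.I * (s : ℂ)) • a)) =
      Complex.exp (Complex.I * (s : ℂ) * φ a) := by
    refine (character_exp φ _).trans ?_
    rw [map_smul, smul_eq_mul]
  rw [h2, Complex.norm_exp] at h
  convert h using 2
  simp
  ring

/-- The character passes under the integral, leaving the Fourier inversion formula at `x`. -/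
theorem character_schwartzCalc {a : A}
    (hw : PolyBdd fun s : ℝ => ‖NormedSpace.exp (s • ((2 * π * Complex.I) • a))‖)
    (φ : WeakDual.characterSpace ℂ A) {x : ℝ} (hx : φ a = x) (h : 𝓢(ℝ, ℂ)) :
    φ (schwartzCalc hw h) = h x := by
  have h1 := (WeakDual.CharacterSpace.toCLM φ).integral_comp_comm
    (integrable_schwartz_smul_exp hw (𝓕 h))
  rw [schwartzCalc_apply]
  refine h1.symm.trans ?_
  conv_rhs => rw [← FourierPair.fourierInv_fourier_eq (F := 𝓢(ℝ, ℂ)) h, fourierInv_coe,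
    Real.fourierInv_eq']
  refine integral_congr_ae (ae_of_all _ fun s => ?_)
  have h2 : WeakDual.CharacterSpace.toCLM φ (NormedSpace.exp (s • ((2 * π * Complex.I) • a))) =
      Complex.exp (s * (2 * π * Complex.I * x)) := by
    refine (character_exp φ _).trans ?_
    rw [← Complex.coe_smul s, map_smul, map_smul, hx]
    simp
  simp only [map_smul, h2]
  rw [smul_eq_mul, smul_eq_mul, mul_comm]
  congr 2
  simp
  ring

/-- An element of polynomial growth of a commutative complex Banach algebra has a smooth
functional calculus on every neighbourhood of its spectrum. -/
theorem exists_calculus_complex {a : A}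
    (ha : PolyBdd fun s : ℝ => ‖NormedSpace.exp ((Complex.I * (s : ℂ)) • a)‖)
    (hV : ∀ x : ℝ, (x : ℂ) ∈ spectrum ℂ a → x ∈ V) :
    ∃ Φ : Smooth V →ₐ[ℝ] A, Continuous Φ ∧ Φ (Smooth.coord V) = a := by
  have hK : IsCompact ((fun x : ℝ => (x : ℂ)) ⁻¹' spectrum ℂ a) :=
    Complex.isometry_ofReal.isClosedEmbedding.isCompact_preimage (spectrum.isCompact a)
  obtain ⟨χ, hχ, hχ1, hc, hχV⟩ := exists_cutoff hK V.isOpen fun x hx => hV x hx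
  have hw := polyBdd_exp_two_pi ha
  let L : Smooth V →ₗ[ℝ] A :=
    ((schwartzCalc hw).restrictScalars ℝ : 𝓢(ℝ, ℂ) →ₗ[ℝ] A) ∘ₗ cutoffMap hχ hc hχV
  have hLc : Continuous L := (schwartzCalc hw).continuous.comp (continuous_cutoffMap hχ hc hχV)
  have hX : ∀ f, L (Smooth.coord V * f) = a * L f := by
    intro f
    have h := schwartzCalc_mul_coord hw (h₁ := cutoffMap hχ hc hχV f)
      (h₂ := cutoffMap hχ hc hχV (Smooth.coord V * f)) fun x => by
        rw [cutoffMap_apply, cutoffMap_apply]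
        by_cases hx : x ∈ V
        · have h := fun f : V → ℝ => ext_apply f ⟨x, hx⟩
          simp only [] at h
          rw [h, h]
          simp [Smooth.coord, Smooth.of]
          ring
        · have : χ x = 0 := image_eq_zero_of_notMem_tsupport fun h => hx (hχV h)
          simp [this]
    rw [mul_smul_comm] at h
    have h0 : (2 * π * Complex.I : ℂ) ≠ 0 := Complex.two_pi_I_ne_zero
    rw [mul_comm a]
    exact smul_right_injective A h0 h
  have hP : ∀ (p : Polynomial ℝ) f, L (Polynomial.aeval (Smooth.coord V) p * f) =
      Polynomial.aeval a p * L f := by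
    intro p
    induction p using Polynomial.induction_on with
    | C r => intro f; simp [← Algebra.smul_def]
    | add p q hp hq => intro f; simp [add_mul, hp, hq]
    | monomial n r ih =>
      intro f
      have h1 := ih (Smooth.coord V * f)
      rw [hX] at h1
      simp only [map_mul, map_pow, Polynomial.aeval_X, pow_succ] at h1 ⊢
      rw [← mul_assoc, mul_assoc _ _ f, h1]
      ring
  -- A non-invertible element is killed by some character, whereas every character takes the value
  -- `χ(φ a) = 1` at `L 1`.
  have hunit : IsUnit (L 1) := by
    by_contra hne
    obtain ⟨φ, hφ⟩ := WeakDual.CharacterSpace.exists_apply_eq_zero hne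
    have hre : φ a = ((φ a).re : ℂ) := by
      apply Complex.ext <;> simp [character_im_eq_zero ha φ]
    have hmem : ((φ a).re : ℂ) ∈ spectrum ℂ a := hre ▸ AlgHom.apply_mem_spectrum φ a
    have h1 := character_schwartzCalc hw φ hre (cutoffMap hχ hc hχV 1)
    rw [cutoffMap_apply, (hχ1 _ hmem).eq_of_nhds,
      show (φ a).re = ((⟨_, hV _ hmem⟩ : V) : ℝ) from rfl, ext_apply] at h1
    have h2 : φ (L 1) = 1 := by
      refine h1.trans ?_
      simp
    exact zero_ne_one (hφ.symm.trans h2)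
  obtain ⟨e, he⟩ := hunit
  -- Dividing by `L 1` makes the map unital without prior knowledge that `L` is multiplicative.
  let M : Smooth V →ₗ[ℝ] A := LinearMap.mulLeft ℝ (e⁻¹ : Aˣ).1 ∘ₗ L
  have hM : ∀ f, M f = (e⁻¹ : Aˣ).1 * L f := fun _ => rfl
  have hMc : Continuous M := continuous_const.mul hLc
  have hM1 : M 1 = 1 := by rw [hM, ← he, Units.inv_mul]
  have hMp : ∀ p : Polynomial ℝ, M (Polynomial.aeval (Smooth.coord V) p) = Polynomial.aeval a p := by
    intro p
    have := hP p 1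
    rw [mul_one] at this
    rw [hM, this, ← he, mul_comm (Polynomial.aeval a p), Units.inv_mul_cancel_left]
  have hMmul : ∀ f g, M (f * g) = M f * M g := by
    intro f g
    refine denseRange_aeval_coord.induction_on
      (p := fun f => M (f * g) = M f * M g) f ?_ fun p => ?_
    · exact isClosed_eq (hMc.comp (continuous_smooth_mul_const g)) (hMc.mul continuous_const)
    · rw [hMp, hM, hM, hP]
      ring
  refine ⟨AlgHom.ofLinearMap M hM1 hMmul, hMc, ?_⟩
  simpa using hMp Polynomial.X

end ComplexCalculus

end PGEnv

namespace PGEnv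

open Complexification

/-! ### Embedding a real Banach algebra in a complex one. -/

section RegularRepresentation

variable (R : Type*) [NormedRing R] [NormedAlgebra ℝ R]

/-- The complex Banach algebra of operators on the space of complex functionals of `R`. -/
def FunctionalOperators : Type _ := (R →L[ℝ] ℂ) →L[ℂ] (R →L[ℝ] ℂ)

noncomputable instance : NormedRing (FunctionalOperators R) :=
  inferInstanceAs (NormedRing ((R →L[ℝ] ℂ) →L[ℂ] (R →L[ℝ] ℂ)))

noncomputable instance : NormedAlgebra ℂ (FunctionalOperators R) :=
  inferInstanceAs (NormedAlgebra ℂ ((R →L[ℝ] ℂ) →L[ℂ] (R →L[ℝ] ℂ)))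

instance : CompleteSpace (FunctionalOperators R) :=
  inferInstanceAs (CompleteSpace ((R →L[ℝ] ℂ) →L[ℂ] (R →L[ℝ] ℂ)))

variable {R}

/-- The operator `f ↦ f (· * b)` on functionals. -/
noncomputable def rightTranslation (b : R) : (R →L[ℝ] ℂ) →L[ℂ] (R →L[ℝ] ℂ) :=
  LinearMap.mkContinuous
    { toFun := fun f => f.comp ((ContinuousLinearMap.mul ℝ R).flip b)
      map_add' := fun _ _ => rfl
      map_smul' := fun _ _ => rfl } ‖b‖ fun f => by
    refine ContinuousLinearMap.opNorm_le_bound _ (by positivity) fun x => ?_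
    refine (f.le_opNorm _).trans ?_
    calc ‖f‖ * ‖x * b‖ ≤ ‖f‖ * (‖x‖ * ‖b‖) := by gcongr; exact norm_mul_le _ _
      _ = ‖b‖ * ‖f‖ * ‖x‖ := by ring

theorem rightTranslation_apply (b : R) (f : R →L[ℝ] ℂ) (x : R) :
    rightTranslation b f x = f (x * b) := rfl

theorem norm_rightTranslation_le (b : R) : ‖rightTranslation b‖ ≤ ‖b‖ :=
  LinearMap.mkContinuous_norm_le _ (norm_nonneg b) _

/-- A norming functional of `b`, translated by `b` and evaluated at 1, recovers `‖b‖`. The factor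
`‖1‖` appears because the identity need not have norm 1. -/
theorem norm_le_norm_rightTranslation (b : R) : ‖b‖ ≤ ‖(1 : R)‖ * ‖rightTranslation b‖ := by
  obtain ⟨g, hg, hgb⟩ := exists_dual_vector'' ℝ b
  let f : R →L[ℝ] ℂ := Complex.ofRealCLM.comp g
  have hf : ‖f‖ ≤ 1 := by
    refine ContinuousLinearMap.opNorm_le_bound _ zero_le_one fun x => ?_
    have h1 : ‖f x‖ = ‖g x‖ := Complex.norm_real _
    rw [h1]
    exact (g.le_opNorm x).trans (by gcongr)
  have h1 : rightTranslation b f 1 = (‖b‖ : ℂ) := by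
    rw [rightTranslation_apply, one_mul]
    exact congrArg Complex.ofReal hgb
  calc ‖b‖ = ‖rightTranslation b f 1‖ := by rw [h1]; simp
    _ ≤ ‖rightTranslation b f‖ * ‖(1 : R)‖ := ContinuousLinearMap.le_opNorm _ _
    _ ≤ ‖rightTranslation b‖ * ‖f‖ * ‖(1 : R)‖ := by gcongr; exact ContinuousLinearMap.le_opNorm _ _
    _ ≤ ‖rightTranslation b‖ * 1 * ‖(1 : R)‖ := by gcongr
    _ = _ := by ring

variable (R) in
/-- The representation of a real Banach algebra by operators on a complex Banach space. -/
noncomputable def regularRep : R →ₐ[ℝ] FunctionalOperators R :=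
  AlgHom.ofLinearMap
    { toFun := fun b => (rightTranslation b : FunctionalOperators R)
      map_add' := fun a b => by
        refine ContinuousLinearMap.ext fun f => ContinuousLinearMap.ext fun x => ?_
        exact (congrArg f (mul_add x a b)).trans (map_add f _ _)
      map_smul' := fun r b => by
        refine ContinuousLinearMap.ext fun f => ContinuousLinearMap.ext fun x => ?_
        refine (congrArg f (mul_smul_comm r x b)).trans ((map_smul f r _).trans ?_)
        exact Complex.real_smul }
    (ContinuousLinearMap.ext fun f => ContinuousLinearMap.ext fun x => congrArg f (mul_one x))
    (fun a b => ContinuousLinearMap.ext fun f => ContinuousLinearMap.ext fun x =>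
      congrArg f (mul_assoc x a b).symm)

theorem norm_regularRep_le (b : R) : ‖regularRep R b‖ ≤ ‖b‖ := norm_rightTranslation_le b

theorem norm_le_norm_regularRep (b : R) : ‖b‖ ≤ ‖(1 : R)‖ * ‖regularRep R b‖ :=
  norm_le_norm_rightTranslation b

theorem continuous_regularRep : Continuous (regularRep R) :=
  AddMonoidHomClass.continuous_of_bound (regularRep R) 1 fun b => by
    simpa using norm_regularRep_le b

theorem isClosedEmbedding_regularRep [CompleteSpace R] :
    Topology.IsClosedEmbedding (regularRep R) := by
  have h : AntilipschitzWith ⟨‖(1 : R)‖, norm_nonneg _⟩ (regularRep R) :=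
    AddMonoidHomClass.antilipschitz_of_bound (regularRep R) fun b => norm_le_norm_regularRep b
  refine h.isClosedEmbedding ?_
  exact (AddMonoidHomClass.lipschitz_of_bound (regularRep R) 1 fun b => by
    simpa using norm_regularRep_le b).uniformContinuous

theorem polyBdd_exp_regularRep [CompleteSpace R] {b : R} (hb : HasPolyGrowth b) :
    PolyBdd fun s : ℝ => ‖NormedSpace.exp ((Complex.I * (s : ℂ)) • regularRep R b)‖ := by
  refine PolyBdd.mono hb fun s => ?_
  rw [← lift_cexp continuous_regularRep, lift_apply, norm_def]
  refine (norm_add_le _ _).trans (add_le_add (norm_regularRep_le _) ?_)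
  rw [norm_smul, Complex.norm_I, one_mul]
  exact norm_regularRep_le _

end RegularRepresentation

/-! ### The calculus for units of real Banach algebras. -/

section RealCalculus

/-- The bicommutant of `a` is closed and commutative and contains `a⁻¹`, so 0 stays outside the
spectrum of `a` relative to it. -/
theorem exists_calculus_of_complex_algebra {S : Type*} [NormedRing S] [NormedAlgebra ℂ S]
    [CompleteSpace S] (a : Sˣ)
    (ha : PolyBdd fun s : ℝ => ‖NormedSpace.exp ((Complex.I * (s : ℂ)) • (a : S))‖) :
    ∃ Φ : Smooth puncturedLine →ₐ[ℝ] S, Continuous Φ ∧ Φ (Smooth.coord puncturedLine) = a := by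
  let A : Subalgebra ℂ S := Subalgebra.centralizer ℂ (Subalgebra.centralizer ℂ {(a : S)} : Set S)
  have hcomm : ∀ x y : A, x * y = y * x := fun x y => Subtype.ext
    (Set.centralizer_centralizer_comm_of_comm (S := {(a : S)}) (by simp) x.1 x.2 y.1 y.2)
  let _ : NormedCommRing A := { (inferInstance : NormedRing A) with mul_comm := hcomm }
  have hclosed : IsClosed (A : Set S) := Set.isClosed_centralizer _
  have : CompleteSpace A := hclosed.completeSpace_coe
  have hmem : ∀ x : S, (∀ y, y * (a : S) = a * y → y * x = x * y) → x ∈ A := fun x hx =>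
    Subalgebra.mem_centralizer_iff ℂ |>.2 fun y hy => hx y
      ((Subalgebra.mem_centralizer_iff ℂ).1 hy _ rfl).symm
  let b : Aˣ :=
    { val := ⟨a, hmem _ fun y hy => hy⟩
      inv := ⟨(a⁻¹ : Sˣ), hmem _ fun y hy =>
        ((show Commute y (a : S) from hy).units_inv_right).eq⟩
      val_inv := Subtype.ext a.mul_inv
      inv_val := Subtype.ext a.inv_mul }
  have hb : PolyBdd fun s : ℝ => ‖NormedSpace.exp ((Complex.I * (s : ℂ)) • (b : A))‖ := by
    refine ha.mono fun s => le_of_eq ?_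
    have h := map_exp_of_normedAlgebra A.val continuous_subtype_val
      ((Complex.I * (s : ℂ)) • (b : A))
    exact congrArg norm h
  obtain ⟨Φ, hΦ, hΦb⟩ := exists_calculus_complex (V := puncturedLine) hb fun x hx h0 => by
    rw [Set.mem_singleton_iff] at h0
    rw [h0, Complex.ofReal_zero] at hx
    exact spectrum.zero_notMem ℂ b.isUnit hx
  refine ⟨(A.val.restrictScalars ℝ).comp Φ, continuous_subtype_val.comp hΦ, ?_⟩
  exact congrArg Subtype.val hΦb

variable {R : Type*} [NormedRing R] [NormedAlgebra ℝ R] [CompleteSpace R]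

/-- An invertible element of polynomial growth of a real Banach algebra has a smooth functional
calculus. -/
theorem exists_calculus (a : Rˣ) (ha : HasPolyGrowth (a : R)) :
    ∃ Φ : Smooth puncturedLine →ₐ[ℝ] R, Continuous Φ ∧ Φ (Smooth.coord puncturedLine) = a := by
  obtain ⟨Ψ, hΨ, hΨa⟩ := exists_calculus_of_complex_algebra
    (Units.map ((regularRep R : R →+* FunctionalOperators R) : R →* FunctionalOperators R) a) (polyBdd_exp_regularRep ha)
  have hemb := isClosedEmbedding_regularRep (R := R)
  -- Polynomials in the coordinate land in the range, which is closed; density does the rest.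
  have hrange : ∀ f, Ψ f ∈ (regularRep R).range := by
    intro f
    refine denseRange_aeval_coord.induction_on (p := fun f => Ψ f ∈ (regularRep R).range) f ?_ fun p => ?_
    · exact hemb.isClosed_range.preimage hΨ
    · refine ⟨Polynomial.aeval (a : R) p, ?_⟩
      change regularRep R _ = _
      rw [← Polynomial.aeval_algHom_apply, ← Polynomial.aeval_algHom_apply, hΨa]
      rfl
  let e := AlgEquiv.ofInjective (regularRep R) hemb.injective
  let Φ : Smooth puncturedLine →ₐ[ℝ] R :=
    (e.symm : _ →ₐ[ℝ] R).comp (Ψ.codRestrict (regularRep R).range hrange)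
  have hΦ : ∀ f, regularRep R (Φ f) = Ψ f := fun f =>
    congrArg Subtype.val (e.apply_symm_apply (Ψ.codRestrict (regularRep R).range hrange f))
  refine ⟨Φ, hemb.isInducing.continuous_iff.2 ?_, hemb.injective ?_⟩
  · convert hΨ using 1
    exact funext hΦ
  · rw [hΦ, hΨa]
    rfl

end RealCalculus

end PGEnv

namespace PGEnv

/-! ### Extension from Laurent polynomials and the universal property. -/

section Lift

open LaurentPolynomial

theorem coordinate_eq_coord :
    (coordinate : Smooth puncturedLine) = Smooth.coord puncturedLine := rfl

theorem laurentEmbedding_T_one : laurentEmbedding (T 1) = Smooth.coord puncturedLine := by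
  change LaurentPolynomial.eval₂ _ _ _ = _
  rw [LaurentPolynomial.eval₂_T, zpow_one, coordinate_eq_coord]

theorem laurentEmbedding_toLaurent (q : Polynomial ℝ) :
    laurentEmbedding (Polynomial.toLaurentAlg q) = Polynomial.aeval (Smooth.coord puncturedLine) q := by
  have h : laurentEmbedding.comp Polynomial.toLaurentAlg =
      Polynomial.aeval (Smooth.coord puncturedLine) := by
    apply Polynomial.algHom_ext
    simp [laurentEmbedding_T_one]
  exact DFunLike.congr_fun h q

theorem denseRange_laurentEmbedding : DenseRange laurentEmbedding :=
  (denseRange_aeval_coord (V := puncturedLine)).mono (by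
    rintro _ ⟨q, rfl⟩
    exact ⟨_, laurentEmbedding_toLaurent q⟩)

/-- The pulled-back topology is locally convex, so the strongest such topology is finer. -/
theorem continuous_laurentEmbedding : Continuous laurentEmbedding :=
  continuous_iff_le_induced.2 <| sInf_le
    ⟨topologicalAddGroup_induced laurentEmbedding, continuousSMul_induced laurentEmbedding,
      LocallyConvexSpace.induced laurentEmbedding.toLinearMap⟩

variable {B : Type*} [NonUnitalNormedRing B] [NormedSpace ℝ B] [IsScalarTower ℝ B B]
  [SMulCommClass ℝ B B]

theorem unitizationInr_injective : Function.Injective (unitizationInr : B → _) :=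
  WithLp.unitization_isometry_inr.injective

theorem unitizationInr_snd {z : WithLp 1 (Unitization ℝ B)} (hz : z.ofLp.fst = 0) :
    unitizationInr z.ofLp.snd = z :=
  (WithLp.equiv 1 (Unitization ℝ B)).injective
    (Unitization.ext (by simpa [unitizationInr_apply] using hz.symm) rfl)

variable [CompleteSpace B]

/-- A homomorphism from the Laurent polynomials to a Banach algebra extends to smooth functions
if the image of the variable has polynomial growth. -/
theorem exists_extension (φ : ℝ[T;T⁻¹] →ₙₐ[ℝ] B) (hφ : IsPolyGrowth (φ (T 1))) :
    ∃ Ψ : Smooth puncturedLine →ₙₐ[ℝ] B, Continuous Ψ ∧ ∀ q, Ψ (laurentEmbedding q) = φ q := by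
  let j : ℝ[T;T⁻¹] →ₙₐ[ℝ] WithLp 1 (Unitization ℝ B) := unitizationInr.comp φ
  have hj : ∀ q, j q = unitizationInr (φ q) := fun _ => rfl
  have hTT : (T 1 * T (-1) : ℝ[T;T⁻¹]) = 1 := by rw [← T_add]; simp
  have hTT' : (T (-1) * T 1 : ℝ[T;T⁻¹]) = 1 := by rw [← T_add]; simp
  have hp : ∀ q, j q * j 1 = j q := fun q => by rw [← map_mul, mul_one]
  have hp' : ∀ q, j 1 * j q = j q := fun q => by rw [← map_mul, one_mul]
  have hbc : j (T 1) * j (T (-1)) = j 1 := by rw [← map_mul, hTT]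
  have hcb : j (T (-1)) * j (T 1) = j 1 := by rw [← map_mul, hTT']
  -- `φ` need not be unital: `j 1` is an idempotent and `j (T 1)` is invertible in its corner.
  -- Adding the complementary idempotent gives a unit of `B₊`.
  let u : (WithLp 1 (Unitization ℝ B))ˣ :=
    { val := (1 - j 1) + j (T 1)
      inv := (1 - j 1) + j (T (-1))
      val_inv := by
        simp only [add_mul, mul_add, sub_mul, mul_sub, one_mul, mul_one, hp, hp', hbc]
        abel
      inv_val := by
        simp only [add_mul, mul_add, sub_mul, mul_sub, one_mul, mul_one, hp, hp', hcb]
        abel }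
  have hup : (u : WithLp 1 (Unitization ℝ B)) * j 1 = j (T 1) := by
    simp only [u, add_mul, sub_mul, one_mul, hp, sub_self, zero_add]
  have hpu : j 1 * (u : WithLp 1 (Unitization ℝ B)) = j (T 1) := by
    simp only [u, mul_add, mul_sub, mul_one, hp, hp', sub_self, zero_add]
  have huc : (u : WithLp 1 (Unitization ℝ B)) * j (T (-1)) = j 1 := by
    simp only [u, add_mul, sub_mul, one_mul, hp', hbc, sub_self, zero_add]
  have hu : HasPolyGrowth (u : WithLp 1 (Unitization ℝ B)) := by
    refine (hasPolyGrowth_of_isIdempotentElem ?_).add ((isPolyGrowth_iff _).1 hφ) ?_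
    · exact IsIdempotentElem.one_sub (hp 1)
    · refine Commute.sub_left (Commute.one_left _) ?_
      exact (hp' (T 1)).trans (hp (T 1)).symm
  obtain ⟨Φ, hΦ, hΦu⟩ := exists_calculus u hu
  have hcomm : ∀ f, Commute (Φ f) (j 1) := by
    intro f
    refine denseRange_aeval_coord.induction_on (p := fun f => Commute (Φ f) (j 1)) f ?_ fun q => ?_
    · exact isClosed_eq (hΦ.mul continuous_const) (continuous_const.mul hΦ)
    · rw [← Polynomial.aeval_algHom_apply, hΦu]
      induction q using Polynomial.induction_on with
      | C r =>
        rw [Polynomial.aeval_C]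
        exact Algebra.commutes r (j 1)
      | add p q hp hq => rw [map_add]; exact hp.add_left hq
      | monomial n r _ =>
        rw [map_mul, map_pow, Polynomial.aeval_X, Polynomial.aeval_C]
        exact Commute.mul_left (Algebra.commutes r (j 1))
          (Commute.pow_left (hup.trans hpu.symm) _)
  have hT : Φ (laurentEmbedding (T 1)) = u := by rw [laurentEmbedding_T_one, hΦu]
  have hTinv : Φ (laurentEmbedding (T (-1))) * j 1 = j (T (-1)) := by
    rw [← huc, ← mul_assoc, ← hT, ← map_mul, ← map_mul, hTT', map_one, map_one, one_mul]
  have hmon : ∀ n : ℤ, Φ (laurentEmbedding (T n)) * j 1 = j (T n) := by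
    intro n
    induction n using Int.induction_on with
    | zero => simp [T_zero]
    | succ n ih =>
      rw [T_add, map_mul, map_mul, mul_assoc, hT, hup, ← hp' (T 1), ← mul_assoc, ih, ← map_mul]
    | pred n ih =>
      rw [sub_eq_add_neg, T_add, map_mul, map_mul, mul_assoc, hTinv, ← hp' (T (-1)), ← mul_assoc,
        ih, ← map_mul]
  have hall : ∀ q, Φ (laurentEmbedding q) * j 1 = j q := by
    intro q
    induction q using LaurentPolynomial.induction_on' with
    | add p q hp hq => rw [map_add, map_add, add_mul, hp, hq, map_add]
    | C_mul_T n a =>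
      rw [← LaurentPolynomial.smul_eq_C_mul, map_smul, map_smul, smul_mul_assoc, hmon, map_smul]
  have hfst : ∀ f, (Φ f * j 1).ofLp.fst = 0 := fun f => by
    rw [WithLp.unitization_mul, Unitization.fst_mul, hj, unitizationInr_apply]
    simp
  have hkey : ∀ f, unitizationInr (Φ f * j 1).ofLp.snd = Φ f * j 1 := fun f =>
    unitizationInr_snd (hfst f)
  -- Compression by `j 1` lands in the ideal `B` of `B₊`, and it is multiplicative because `j 1` is
  -- an idempotent commuting with the values of `Φ`.
  let Ψ : Smooth puncturedLine →ₙₐ[ℝ] B :=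
    { toFun := fun f => (Φ f * j 1).ofLp.snd
      map_smul' := fun c f => by rw [map_smul, smul_mul_assoc]; rfl
      map_zero' := by rw [map_zero, zero_mul]; rfl
      map_add' := fun f g => by rw [map_add, add_mul]; rfl
      map_mul' := fun f g => unitizationInr_injective (by
        rw [map_mul unitizationInr, hkey, hkey, hkey, map_mul, mul_assoc (Φ f) (j 1),
          ← mul_assoc (j 1), ← (hcomm g).eq, mul_assoc (Φ g), hp, mul_assoc]) }
  refine ⟨Ψ, continuous_unitization_snd.comp (hΦ.mul continuous_const), fun q => ?_⟩
  refine unitizationInr_injective ((hkey _).trans ?_)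
  rw [hall, hj]

/-- Continuous homomorphisms on `C^∞(ℝ ∖ {0})` are determined by their values on Laurent
polynomials. -/
theorem eq_of_eq_on_laurent {C : Type*} [TopologicalSpace C] [T2Space C]
    {f g : Smooth puncturedLine → C} (hf : Continuous f) (hg : Continuous g)
    (h : ∀ q, f (laurentEmbedding q) = g (laurentEmbedding q)) : f = g :=
  denseRange_laurentEmbedding.equalizer hf hg (funext h)

/-- Each component extends separately; density of the Laurent polynomials makes the extensions
compatible and the lift unique. -/
theorem existsUnique_lift_of_isPGL {B : Type u} [NonUnitalRing B] [Module ℝ B] [TopologicalSpace B]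
    (hB : IsPGL B) (φ : ℝ[T;T⁻¹] →ₙₐ[ℝ] B) :
    ∃! ψ : Smooth puncturedLine →ₙₐ[ℝ] B, Continuous ψ ∧
      ψ.comp (laurentEmbedding : ℝ[T;T⁻¹] →ₙₐ[ℝ] Smooth puncturedLine) = φ := by
  obtain ⟨ι, _, _, _, S, e, he⟩ := hB
  have hex := fun i => exists_extension (((evalHom i).comp
    (NonUnitalSubalgebraClass.subtype S.limit)).comp (e.comp φ)) (S.isPG i _)
  choose ψ hψ hψφ using hex
  let Ψ : Smooth puncturedLine →ₙₐ[ℝ] S.limit :=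
    NonUnitalAlgHom.codRestrict (piHom (F := fun i => (S.obj i : Type u)) ψ) S.limit
      fun f i k h => congrFun (eq_of_eq_on_laurent (f := fun f => S.map h (ψ k f)) (g := ψ i)
        ((S.continuous_map h).comp (hψ k)) (hψ i) fun q => by
          rw [hψφ, hψφ]
          exact (e (φ q)).2 i k h) f
  have hΨ : Continuous Ψ := by
    have hc : Continuous fun f i => ψ i f := continuous_pi hψ
    exact hc.subtype_mk _
  let d : B ≃ₜ S.limit := he.homeomorph
  have hd : ∀ y, e (d.symm y) = y := d.apply_symm_apply
  let θ : Smooth puncturedLine →ₙₐ[ℝ] B :=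
    { toFun := fun f => d.symm (Ψ f)
      map_smul' := fun c f => he.injective (by simp only [map_smul, hd, MonoidHom.id_apply])
      map_zero' := he.injective (by simp only [map_zero, hd])
      map_add' := fun f g => he.injective (by simp only [map_add, hd])
      map_mul' := fun f g => he.injective (by simp only [map_mul, hd]) }
  have hθ : ∀ q, θ (laurentEmbedding q) = φ q := fun q => he.injective ((hd _).trans
    (Subtype.ext (funext fun i => hψφ i q)))
  refine ⟨θ, ⟨d.symm.continuous.comp hΨ, NonUnitalAlgHom.ext hθ⟩, ?_⟩
  rintro θ' ⟨hc, hθ'⟩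
  refine NonUnitalAlgHom.ext fun f => he.injective (congrFun (eq_of_eq_on_laurent
    (he.continuous.comp hc) (he.continuous.comp (d.symm.continuous.comp hΨ)) fun q => ?_) f)
  exact congrArg e ((DFunLike.congr_fun hθ' q).trans (hθ q).symm)

theorem isPGEnvelope_laurentEmbedding :
    IsPGEnvelope.{u} (laurentEmbedding : ℝ[T;T⁻¹] →ₙₐ[ℝ] Smooth puncturedLine) where
  isPGL := isPGL_smooth _
  continuous := continuous_laurentEmbedding
  existsUnique_lift _ _ _ _ _ _ hB φ _ := existsUnique_lift_of_isPGL hB φ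

/-- In a unital algebra, the adjoined identity may be replaced by the given one. -/
theorem IsPolyGrowth.hasPolyGrowth {B : Type*} [NormedRing B] [NormedAlgebra ℝ B] [CompleteSpace B]
    {b : B} (hb : IsPolyGrowth b) : HasPolyGrowth b := by
  let p : B →ₙₐ[ℝ] Complexification B := (Complexification.ofReal : B →ₐ[ℝ] Complexification B)
  have hp : Continuous p := Complexification.continuous_ofReal
  have hpb : ∀ x, p x = Complexification.mk x 0 := fun _ => rfl
  refine ((polyBdd_const ‖(1 : Complexification B)‖).add (polyBdd_norm_expI hb)).mono fun s => ?_
  -- The adjoined identity is sent to that of `B`, so the unital exponential is an image of `expI s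
  -- b`, of norm at most `‖1‖ + ‖expI s b‖`.
  have h : cexp s b = Complexification.lift (unitizationLift p) (expI s b) := (lift_expI hp s b).symm
  rw [h, Complexification.lift_apply, unitizationLift_apply, unitizationLift_apply, (re_expI_fst s b).1,
    (re_expI_fst s b).2, map_one, map_zero, zero_add, add_assoc]
  refine (norm_add_le _ _).trans ?_
  gcongr
  refine (norm_add_le _ _).trans ?_
  rw [norm_expI, hpb, hpb, Complexification.norm_def, Complexification.norm_def]
  simp

theorem existsUnique_calculus {B : Type u} [NormedRing B] [NormedAlgebra ℝ B] [CompleteSpace B]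
    (b : Bˣ) (hb : IsPolyGrowth (b : B)) :
    ∃! Φ : Smooth puncturedLine →ₐ[ℝ] B,
      Continuous Φ ∧ Φ (coordinate : Smooth puncturedLine) = b := by
  obtain ⟨Φ, hΦ, hΦb⟩ := exists_calculus b hb.hasPolyGrowth
  refine ⟨Φ, ⟨hΦ, hΦb⟩, ?_⟩
  rintro Ψ ⟨hΨ, hΨb⟩
  -- Ordinary polynomials are already dense, so `x⁻¹` plays no role in uniqueness.
  refine DFunLike.coe_injective (denseRange_aeval_coord.equalizer hΨ hΦ (funext fun q => ?_))
  change Ψ (Polynomial.aeval _ q) = Φ (Polynomial.aeval _ q)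
  rw [← Polynomial.aeval_algHom_apply, ← Polynomial.aeval_algHom_apply, hΦb,
    ← coordinate_eq_coord, hΨb]

end Lift

end PGEnv

theorem mainTheorem7 :
    PGEnv.IsPGEnvelope.{u} (PGEnv.laurentEmbedding :
      LaurentPolynomial ℝ →ₙₐ[ℝ] PGEnv.Smooth PGEnv.puncturedLine) ∧
    ∀ (B : Type u) [NormedRing B] [NormedAlgebra ℝ B] [CompleteSpace B] (b : Bˣ),
      PGEnv.IsPolyGrowth (b : B) →
      ∃! Φ : PGEnv.Smooth PGEnv.puncturedLine →ₐ[ℝ] B,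
        Continuous Φ ∧ Φ (PGEnv.coordinate : PGEnv.Smooth PGEnv.puncturedLine) = b :=
  ⟨PGEnv.isPGEnvelope_laurentEmbedding, fun _ _ _ _ b hb => PGEnv.existsUnique_calculus b hb⟩
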